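/- Let $N\ge 0$ be an integer and $g\in\mathbb{C}$. On the field $\mathbb{C}(x_1,\dots,x_N)$ of rational functions let a permutation $\sigma\in S_N$ act by permuting the variables, $x_i\mapsto x_{\sigma(i)}$, let $s_{ij}$ be the transposition of $i$ and $j$, and put $$\nabla_i=\partial_{x_i}-\sum_{j\ne i}\frac{g}{x_i-x_j}\,s_{ij},\qquad a_i^{+}=\tfrac{\sqrt2}{2}(x_i-\nabla_i),\qquad a_i=\tfrac{\sqrt2}{2}(x_i+\nabla_i),\qquad E_{kl}=a_k^{+}a_l .$$ Let $H_g\,gl(N)$ be the algebra of operators generated over $\mathbb{C}$ by all $E_{kl}$ ($1\le k,l\le N$) and by the group algebra $\mathbb{C}S_N$. In $\mathbb{C}S_N$ put $S_{ij}=-g\,s_{ij}$ for $i\ne j$ and $S_{ii}=1+g\sum_{k\ne i}s_{ik}$. Let $V=\mathbb{C}^N$ with basis $e_1,\dots,e_N$ permuted by $S_N$, let $T(V\otimes V)\#\mathbb{C}S_N$ be the smash product, and write $E_{ij}$ also for its element $(e_i\otimes e_j)\cdot 1$. (1) The assignments $E_{ij}\mapsto E_{ij}$, $\sigma\mapsto\sigma$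 induce an isomorphism of $\mathbb{C}$-algebras from the quotient of $T(V\otimes V)\#\mathbb{C}S_N$ by the two-sided ideal generated by the relations $$E_{ij}(E_{kl}+S_{kl})-E_{il}(E_{kj}+S_{kj})=0,\qquad (E_{ij}+S_{ij})E_{kl}-(E_{kj}+S_{kj})E_{il}=0\qquad(1\le i,j,k,l\le N)$$ onto $H_g\,gl(N)$. (2) For every $g\in\mathbb{C}$ the monomials $$E_{i_1j_1}^{n_1}\cdots E_{i_kj_k}^{n_k}\,\sigma,\qquad k\ge 0,\quad n_s>0,\quad i_1\le\dots\le i_k,\quad j_1\le\dots\le j_k,\quad \sigma\in S_N,$$ with pairwise distinct pairs $(i_s,j_s)$, form a basis of $H_g\,gl(N)$. (3) With these relations $H_g\,gl(N)$ is a nonhomogeneous quadratic algebra over $\mathbb{C}S_N$ of Poincaré–Birkhoff–Witt type: grade $T(V\otimes V)\#\mathbb{C}S_N$ by tensor degree, with $S_N$ in degree $0$, and give the quotient in (1) the induced filtration. The relations have degree at most $2$, and the natural map from the quotient of $T(V\otimes V)\#\mathbb{C}S_N$ by the quadratic parts of the relations to the associated graded algebra of the quotient in (1) is a well defined isomorphism.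 -/

import Mathlib

open scoped TensorProduct

noncomputable section

namespace DunklGl

/-! ### Operators on the field of rational functions -/

/-- The field `ℂ(x₁, …, x_N)` of rational functions on `ℂ^N`. -/
abbrev RatFun (N : ℕ) : Type := FractionRing (MvPolynomial (Fin N) ℂ)

section Derivative

variable {N : ℕ} (d : Derivation ℂ (MvPolynomial (Fin N) ℂ) (MvPolynomial (Fin N) ℂ))

/-- The quotient rule, for a chosen numerator and denominator of the rational function `f`. -/
def quotRule (f : RatFun N) : RatFun N :=
  let p := (IsLocalization.sec (nonZeroDivisors (MvPolynomial (Fin N) ℂ)) f).1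
  let q : MvPolynomial (Fin N) ℂ :=
    (IsLocalization.sec (nonZeroDivisors (MvPolynomial (Fin N) ℂ)) f).2
  algebraMap _ (RatFun N) (d p * q - p * d q) / algebraMap _ (RatFun N) q ^ 2

/-- The quotient rule does not depend on the numerator and denominator. -/
theorem quotRule_div (a b : MvPolynomial (Fin N) ℂ) (hb : b ≠ 0) :
    quotRule d (algebraMap _ (RatFun N) a / algebraMap _ (RatFun N) b) =
      algebraMap _ (RatFun N) (d a * b - a * d b) / algebraMap _ (RatFun N) b ^ 2 := by
  set f : RatFun N := algebraMap _ (RatFun N) a / algebraMap _ (RatFun N) b with hf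
  have hs := IsLocalization.sec_spec (nonZeroDivisors (MvPolynomial (Fin N) ℂ)) f
  have hq0 := nonZeroDivisors.ne_zero
    (IsLocalization.sec (nonZeroDivisors (MvPolynomial (Fin N) ℂ)) f).2.2
  unfold quotRule
  simp only
  generalize (IsLocalization.sec (nonZeroDivisors (MvPolynomial (Fin N) ℂ)) f).1 = p at *
  generalize ((IsLocalization.sec (nonZeroDivisors (MvPolynomial (Fin N) ℂ)) f).2 :
    MvPolynomial (Fin N) ℂ) = q at *
  have inj : Function.Injective (algebraMap (MvPolynomial (Fin N) ℂ) (RatFun N)) :=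
    IsFractionRing.injective _ _
  have hbK : algebraMap _ (RatFun N) b ≠ 0 := fun h => hb (inj (by rw [h, map_zero]))
  have hqK : algebraMap _ (RatFun N) q ≠ 0 := fun h => hq0 (inj (by rw [h, map_zero]))
  have e : a * q = p * b := by
    apply inj
    rw [map_mul, map_mul, ← hs, hf]
    field_simp
  have de : d a * q + a * d q = d p * b + p * d b := by
    have := congrArg d e
    simp only [Derivation.leibniz, smul_eq_mul] at this
    linear_combination this
  rw [div_eq_div_iff (pow_ne_zero 2 hqK) (pow_ne_zero 2 hbK), ← map_pow, ← map_pow, ← map_mul,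
    ← map_mul]
  congr 1
  linear_combination (-b * q) * de + (b * d q + q * d b) * e

theorem exists_div (f : RatFun N) : ∃ a b : MvPolynomial (Fin N) ℂ, b ≠ 0 ∧
    f = algebraMap _ (RatFun N) a / algebraMap _ (RatFun N) b := by
  obtain ⟨a, b, hb, rfl⟩ := IsFractionRing.div_surjective (MvPolynomial (Fin N) ℂ) f
  exact ⟨a, b, nonZeroDivisors.ne_zero hb, rfl⟩

theorem algebraMap_ne {b : MvPolynomial (Fin N) ℂ} (hb : b ≠ 0) :
    algebraMap _ (RatFun N) b ≠ 0 := fun h =>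
  hb (IsFractionRing.injective (MvPolynomial (Fin N) ℂ) (RatFun N) (by rw [h, map_zero]))

theorem algebraMap_smul_ratFun (c : ℂ) (p : MvPolynomial (Fin N) ℂ) :
    algebraMap _ (RatFun N) (c • p) = c • algebraMap _ (RatFun N) p :=
  Algebra.algebraMap_eq_smul_one (R := MvPolynomial (Fin N) ℂ) (A := RatFun N) (c • p) ▸ by
    rw [smul_assoc, ← Algebra.algebraMap_eq_smul_one]

/-- The quotient rule as a linear map. -/
def quotRuleLinear : RatFun N →ₗ[ℂ] RatFun N :=
    { toFun := quotRule d
      map_add' := by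
        intro f h
        obtain ⟨a, b, hb, rfl⟩ := exists_div f
        obtain ⟨a', b', hb', rfl⟩ := exists_div h
        have h1 := algebraMap_ne hb
        have h2 := algebraMap_ne hb'
        have e : algebraMap _ (RatFun N) a / algebraMap _ (RatFun N) b +
            algebraMap _ (RatFun N) a' / algebraMap _ (RatFun N) b' =
            algebraMap _ (RatFun N) (a * b' + a' * b) / algebraMap _ (RatFun N) (b * b') := by
          simp only [map_add, map_mul]
          field_simp
        rw [e, quotRule_div d _ _ (mul_ne_zero hb hb'), quotRule_div d _ _ hb,
          quotRule_div d _ _ hb']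
        simp only [map_add, map_sub, map_mul, Derivation.leibniz, smul_eq_mul]
        field_simp
        ring
      map_smul' := by
        intro c f
        obtain ⟨a, b, hb, rfl⟩ := exists_div f
        have h1 := algebraMap_ne hb
        have e : c • (algebraMap _ (RatFun N) a / algebraMap _ (RatFun N) b) =
            algebraMap _ (RatFun N) (c • a) / algebraMap _ (RatFun N) b := by
          rw [← smul_div_assoc, algebraMap_smul_ratFun]
        rw [e, quotRule_div d _ _ hb, quotRule_div d _ _ hb, Derivation.map_smul, smul_mul_assoc,
          smul_mul_assoc, ← smul_sub, RingHom.id_apply, ← smul_div_assoc,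
          algebraMap_smul_ratFun] }

/-- The extension of a derivation of the polynomial ring to the field of rational functions. -/
def extendDerivation : Derivation ℂ (RatFun N) (RatFun N) :=
  Derivation.mk' (quotRuleLinear d)
    (by
      intro f h
      obtain ⟨a, b, hb, rfl⟩ := exists_div f
      obtain ⟨a', b', hb', rfl⟩ := exists_div h
      have h1 := algebraMap_ne hb
      have h2 := algebraMap_ne hb'
      have e : algebraMap _ (RatFun N) a / algebraMap _ (RatFun N) b *
          (algebraMap _ (RatFun N) a' / algebraMap _ (RatFun N) b') =
          algebraMap _ (RatFun N) (a * a') / algebraMap _ (RatFun N) (b * b') := by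
        simp only [map_mul]
        field_simp
      change quotRule d _ = _ * quotRule d _ + _ * quotRule d _
      rw [e, quotRule_div d _ _ (mul_ne_zero hb hb'), quotRule_div d _ _ hb,
        quotRule_div d _ _ hb']
      simp only [map_add, map_sub, map_mul, Derivation.leibniz, smul_eq_mul]
      field_simp
      ring)

theorem extendDerivation_algebraMap (p : MvPolynomial (Fin N) ℂ) :
    extendDerivation d (algebraMap _ (RatFun N) p) = algebraMap _ (RatFun N) (d p) := by
  have h := quotRule_div d p 1 one_ne_zero
  simp only [map_one, div_one, mul_one, Derivation.map_one_eq_zero, mul_zero, sub_zero,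
    one_pow] at h
  exact h

end Derivative

/-- The coordinate function `x_i`. -/
def coord {N : ℕ} (i : Fin N) : RatFun N :=
  algebraMap (MvPolynomial (Fin N) ℂ) (RatFun N) (MvPolynomial.X i)

/-- The operator of multiplication by `f`. -/
def mulOp {N : ℕ} (f : RatFun N) : Module.End ℂ (RatFun N) := LinearMap.mulLeft ℂ f

/-- The partial derivative `∂_i`. -/
def partialOp {N : ℕ} (i : Fin N) : Module.End ℂ (RatFun N) :=
  (extendDerivation (MvPolynomial.pderiv i)).toLinearMap

/-- The action of a permutation by permuting the variables: `x_i ↦ x_{σ i}`. -/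
def permOp {N : ℕ} (σ : Equiv.Perm (Fin N)) : Module.End ℂ (RatFun N) :=
  (IsFractionRing.algEquivOfAlgEquiv (R := ℂ) (K := RatFun N) (L := RatFun N)
    (MvPolynomial.renameEquiv ℂ σ)).toLinearMap

/-- The gauged Dunkl operator `∇_i = ∂_i - ∑_{j ≠ i} g / (x_i - x_j) s_{ij}`. -/
def nabla {N : ℕ} (g : ℂ) (i : Fin N) : Module.End ℂ (RatFun N) :=
  partialOp i - ∑ j ∈ Finset.univ.erase i,
    mulOp (algebraMap ℂ (RatFun N) g / (coord i - coord j)) * permOp (Equiv.swap i j)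

/-- The creation operator `a_i^+ = (√2 / 2) (x_i - ∇_i)`. -/
def creation {N : ℕ} (g : ℂ) (i : Fin N) : Module.End ℂ (RatFun N) :=
  ((Real.sqrt 2 : ℂ) / 2) • (mulOp (coord i) - nabla g i)

/-- The annihilation operator `a_i = (√2 / 2) (x_i + ∇_i)`. -/
def annihilation {N : ℕ} (g : ℂ) (i : Fin N) : Module.End ℂ (RatFun N) :=
  ((Real.sqrt 2 : ℂ) / 2) • (mulOp (coord i) + nabla g i)

/-- The operator `E_{kl} = a_k^+ a_l`. -/
def EOp {N : ℕ} (g : ℂ) (k l : Fin N) : Module.End ℂ (RatFun N) :=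
  creation g k * annihilation g l

/-- The algebra `H_g gl(N)`, generated by the operators `E_{kl}` and the group algebra of the
symmetric group. -/
def Hgl (N : ℕ) (g : ℂ) : Subalgebra ℂ (Module.End ℂ (RatFun N)) :=
  Algebra.adjoin ℂ ({T | ∃ k l : Fin N, T = EOp g k l} ∪
    {T | ∃ σ : Equiv.Perm (Fin N), T = permOp σ})

theorem EOp_mem {N : ℕ} (g : ℂ) (k l : Fin N) : EOp g k l ∈ Hgl N g :=
  Algebra.subset_adjoin (Or.inl ⟨k, l, rfl⟩)

theorem permOp_mem {N : ℕ} (g : ℂ) (σ : Equiv.Perm (Fin N)) : permOp σ ∈ Hgl N g :=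
  Algebra.subset_adjoin (Or.inr ⟨σ, rfl⟩)

/-! ### The smash product `T(V ⊗ V) # ℂ S_N` -/

/-- The permutation representation `V = ℂ^N`. -/
abbrev V (N : ℕ) : Type := Fin N → ℂ

/-- The action of a permutation on `V`: `e_i ↦ e_{σ i}`. -/
def permV {N : ℕ} (σ : Equiv.Perm (Fin N)) : V N →ₗ[ℂ] V N := LinearMap.funLeft ℂ ℂ ⇑σ⁻¹

theorem permV_mul {N : ℕ} (σ τ : Equiv.Perm (Fin N)) : permV (σ * τ) = permV σ ∘ₗ permV τ := by
  ext
  simp [permV, LinearMap.funLeft_apply]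

theorem permV_single {N : ℕ} (σ : Equiv.Perm (Fin N)) (i : Fin N) :
    permV σ (Pi.single i 1) = Pi.single (σ i) 1 := by
  ext k
  simp only [permV, LinearMap.funLeft_apply, Pi.single_apply]
  congr 1
  rw [Equiv.Perm.inv_eq_iff_eq, eq_comm (a := k)]

/-- The tensor algebra `T(V ⊗ V)`. -/
abbrev TensorGl (N : ℕ) : Type := TensorAlgebra ℂ (V N ⊗[ℂ] V N)

/-- The action of a permutation on `T(V ⊗ V)`, induced by the diagonal action on `V ⊗ V`. -/
def permT {N : ℕ} (σ : Equiv.Perm (Fin N)) : TensorGl N →ₐ[ℂ] TensorGl N :=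
  TensorAlgebra.lift ℂ (TensorAlgebra.ι ℂ ∘ₗ TensorProduct.map (permV σ) (permV σ))

theorem permT_one {N : ℕ} : permT (1 : Equiv.Perm (Fin N)) = AlgHom.id ℂ (TensorGl N) := by
  ext
  simp [permT, permV]

theorem permT_mul {N : ℕ} (σ τ : Equiv.Perm (Fin N)) : 
    permT (σ * τ) = (permT σ).comp (permT τ) := by
  ext
  simp [permT, permV_mul]

instance (N : ℕ) : MulSemiringAction (Equiv.Perm (Fin N)) (TensorGl N) where
  smul σ x := permT σ x
  one_smul x := by
    change permT 1 x = x
    rw [permT_one]; rfl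
  mul_smul σ τ x := by
    change permT (σ * τ) x = permT σ (permT τ x)
    rw [permT_mul]; rfl
  smul_zero σ := map_zero (permT σ)
  smul_add σ := map_add (permT σ)
  smul_one σ := map_one (permT σ)
  smul_mul σ := map_mul (permT σ)

instance (N : ℕ) : SMulCommClass (Equiv.Perm (Fin N)) ℂ (TensorGl N) where
  smul_comm σ c x := map_smul (permT σ) c x

/-- The smash product `T(V ⊗ V) # ℂ S_N`: it consists of the finite sums of terms `t σ`, multiplied
by the rule `(t σ) (t' τ) = t (σ • t') σ τ`. -/
abbrev Smash (N : ℕ) : Type := SkewMonoidAlgebra (TensorGl N) (Equiv.Perm (Fin N))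

/-- The generator `E_{ij} = (e_i ⊗ e_j) 1`. -/
def genE {N : ℕ} (i j : Fin N) : Smash N :=
  SkewMonoidAlgebra.single 1 (TensorAlgebra.ι ℂ (Pi.single i 1 ⊗ₜ[ℂ] Pi.single j 1))

/-- The group element `σ`. -/
def genPerm {N : ℕ} (σ : Equiv.Perm (Fin N)) : Smash N := SkewMonoidAlgebra.single σ 1

/-- `S_{ij} = - g s_{ij}` for `i ≠ j`, and `S_{ii} = 1 + g ∑_{k ≠ i} s_{ik}`. -/
def genS {N : ℕ} (g : ℂ) (i j : Fin N) : Smash N :=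
  if i = j then 1 + g • ∑ k ∈ Finset.univ.erase i, genPerm (Equiv.swap i k)
  else -(g • genPerm (Equiv.swap i j))

/-- The relations: `E_{ij} (E_{kl} + S_{kl})` antisymmetrised over `j, l`, and
`(E_{ij} + S_{ij}) E_{kl}` antisymmetrised over `i, k`. -/
def crossingRelations (N : ℕ) (g : ℂ) : Set (Smash N) :=
  {r | ∃ i j k l : Fin N,
      r = genE i j * (genE k l + genS g k l) - genE i l * (genE k j + genS g k j)} ∪
  {r | ∃ i j k l : Fin N,
      r = (genE i j + genS g i j) * genE k l - (genE k j + genS g k j) * genE i l}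

/-- The grading of the smash product by the degree of tensors; `S_N` has degree zero. -/
def smashGrading (N n : ℕ) : Submodule ℂ (Smash N) where
  carrier := {f | ∀ σ, f.coeff σ ∈
    (LinearMap.range (TensorAlgebra.ι ℂ : V N ⊗[ℂ] V N →ₗ[ℂ] TensorGl N)) ^ n}
  add_mem' hf hh σ := by
    rw [SkewMonoidAlgebra.coeff_add]
    exact add_mem (hf σ) (hh σ)
  zero_mem' σ := by
    rw [SkewMonoidAlgebra.coeff_zero]
    exact zero_mem _
  smul_mem' c f hf σ := by
    rw [SkewMonoidAlgebra.coeff_smul]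
    exact Submodule.smul_mem _ c (hf σ)

/-! ### Nonhomogeneous quadratic algebras of Poincaré–Birkhoff–Witt type -/

section PBW

variable {T : Type*} [Ring T] [Algebra ℂ T]

/-- The quotient of `T` by the two-sided ideal generated by `P`. -/
abbrev RelQuot (P : Set T) : Type _ := RingQuot (fun x y : T => x ∈ P ∧ y = 0)

/-- The quotient map. -/
abbrev relProj (P : Set T) : T →ₐ[ℂ] RelQuot P :=
  RingQuot.mkAlgHom ℂ (fun x y : T => x ∈ P ∧ y = 0)

variable (𝒯 : ℕ → Submodule ℂ T) (P : Set T)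

/-- The quadratic parts of the relations. -/
def quadraticPart : Set T := {r | r ∈ 𝒯 2 ∧ ∃ p ∈ P, p - r ∈ 𝒯 0 ⊔ 𝒯 1}

/-- The step `F_n` of the filtration of `T / (P)` induced by the grading of `T`. -/
def filtLE (n : ℕ) : Submodule ℂ (RelQuot P) :=
  ⨆ m ≤ n, (𝒯 m).map (relProj P).toLinearMap

/-- The step `F_{n - 1}` of the filtration (zero for `n = 0`). -/
def filtLT (n : ℕ) : Submodule ℂ (RelQuot P) :=
  ⨆ m < n, (𝒯 m).map (relProj P).toLinearMap

/-- The component `F_n / F_{n - 1}` of degree `n` of the associated graded algebra of `T / (P)`. -/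
abbrev gradedPiece (n : ℕ) : Type _ :=
  filtLE 𝒯 P n ⧸ (filtLT 𝒯 P n).submoduleOf (filtLE 𝒯 P n)

/-- The component of degree `n` of the homogeneous quadratic algebra `T / (R)`, where `R` consists
of the quadratic parts of the relations `P`. -/
def quadraticPiece (n : ℕ) : Submodule ℂ (RelQuot (quadraticPart 𝒯 P)) :=
  (𝒯 n).map (relProj (quadraticPart 𝒯 P)).toLinearMap

theorem relProj_mem_filtLE {n : ℕ} {x : T} (hx : x ∈ 𝒯 n) : relProj P x ∈ filtLE 𝒯 P n :=
  (le_iSup₂ (f := fun m (_ : m ≤ n) => (𝒯 m).map (relProj P).toLinearMap) n le_rfl)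
    (Submodule.mem_map_of_mem (f := (relProj P).toLinearMap) hx)

theorem relProj_mem_quadraticPiece {n : ℕ} {x : T} (hx : x ∈ 𝒯 n) :
    relProj (quadraticPart 𝒯 P) x ∈ quadraticPiece 𝒯 P n :=
  Submodule.mem_map_of_mem (f := (relProj (quadraticPart 𝒯 P)).toLinearMap) hx

/-- Let `T` be graded by `𝒯` (a tensor algebra over its degree zero component). The algebra
`A = T / (P)` is a nonhomogeneous quadratic algebra of Poincaré–Birkhoff–Witt type if `P` lies in
degrees at most two and the natural map `T / (R) → gr A` from the homogeneous quadratic algebra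
of the quadratic parts `R` of `P` to the associated graded algebra is an isomorphism, that is,
it is well defined and bijective in each degree.

The quadratic parts of the elements of the bimodule over the degree zero component spanned by `P`
form the bimodule spanned by `R`, so that it makes no difference whether `P` itself is required to
be a bimodule. -/
structure IsPBWQuadratic : Prop where
  nonhomogeneous_quadratic : ∀ p ∈ P, p ∈ 𝒯 0 ⊔ 𝒯 1 ⊔ 𝒯 2
  graded_iso : ∀ n : ℕ, ∃ e : quadraticPiece 𝒯 P n ≃ₗ[ℂ] gradedPiece 𝒯 P n,
    ∀ (x : T) (hx : x ∈ 𝒯 n),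
      e ⟨relProj (quadraticPart 𝒯 P) x, relProj_mem_quadraticPiece 𝒯 P hx⟩ =
        Submodule.Quotient.mk ⟨relProj P x, relProj_mem_filtLE 𝒯 P hx⟩

end PBW

/-! ### The monomials -/

/-- A sequence `(i_1, j_1, n_1), …, (i_k, j_k, n_k)` of indices and exponents, with `k ≥ 0` and all
`n_s > 0`, such that `i_1 ≤ … ≤ i_k` and `j_1 ≤ … ≤ j_k`. The pairs `(i_s, j_s)` are distinct:
repeated factors are collected into powers. -/
def OrderedSeq (N : ℕ) : Type :=
  {L : List (Fin N × Fin N × ℕ) // (∀ s ∈ L, 0 < s.2.2) ∧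
    L.Pairwise (fun s t => s.1 ≤ t.1 ∧ s.2.1 ≤ t.2.1 ∧ ¬ (s.1 = t.1 ∧ s.2.1 = t.2.1))}

/-- The monomial `E_{i_1 j_1}^{n_1} … E_{i_k j_k}^{n_k} σ`. -/
def monomialOp {N : ℕ} (g : ℂ) (m : OrderedSeq N × Equiv.Perm (Fin N)) :
    Module.End ℂ (RatFun N) :=
  (m.1.1.map (fun s => EOp g s.1 s.2.1 ^ s.2.2)).prod * permOp m.2

end DunklGl

end

open DunklGl

open scoped TensorProduct

noncomputable section

namespace DunklGl

/-! ### Calculus of the operators -/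

section Operators

variable {N : ℕ}

/-! Up to the factor 1/2, `E_{kl}` is the product of the raising operator `x_k - ∇_k` and the
lowering operator `x_l + ∇_l`. The Dunkl operators commute (`nabla_comm`), and the commutator of
`∇_i` with `x_j` is `S_{ij}` (`nabla_mul_coord`). Hence raising operators commute among themselves,
lowering operators do too, and `E_{kl} + S_{kl}` is half the product in the opposite order, lowering
first (`EOp_add_SOp`). In each crossing relation two lowering or two raising operators stand side by
side, so the relation is their commutativity. This gives a surjection `quotHom` from the abstract
quotient onto the algebra of operators.

Two bounds meet at the ordered monomials. Spanning is seen in the homogeneous quadratic algebra: its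
relations allow first and second indices to be permuted independently, so every word can be sorted
(`exists_orderedSeq_prod_eq`). Induction on the degree carries the spanning over to the filtered
quotient, because whatever vanishes in the quadratic algebra drops in filtration there
(`relProj_mem_filtLT_of_relProj_quadraticPart_eq_zero`).

Independence is seen on operators (`linearIndependent_monomialOp`). Counting only factors `x`, the
product of the `E_{i_s j_s}` followed by `σ` has leading term `∏ x_{i_s} ∏ (x + ∇)_{j_s} σ`, which
remembers both multisets of indices and hence the ordered sequence. These leading terms are
independent over `ℂ` because the operators `(x + ∇)^t σ` are independent over `ℂ(x)`. That reduces
to `∂^t σ`, where distinct `σ` are separated by generalised eigenvalues of right multiplication by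
the coordinates.

So the monomials form a basis of the quotient and remain independent as operators. This gives the
isomorphism, the basis and the Poincaré–Birkhoff–Witt property together, for every `g` and without
any check of overlaps between relations. -/

theorem mulOp_apply (f h : RatFun N) : mulOp f h = f * h := rfl

theorem mulOp_one : mulOp (1 : RatFun N) = 1 := by
  ext h; simp [mulOp_apply]

theorem mulOp_zero : mulOp (0 : RatFun N) = 0 := by
  ext h; simp [mulOp_apply]

theorem mulOp_mul (f h : RatFun N) : mulOp (f * h) = mulOp f * mulOp h := by
  ext k; simp [mulOp_apply, mul_assoc]

theorem mulOp_sub (f h : RatFun N) : mulOp (f - h) = mulOp f - mulOp h := by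
  ext k; simp [mulOp_apply, sub_mul]

theorem mulOp_comm (f h : RatFun N) : mulOp f * mulOp h = mulOp h * mulOp f := by
  rw [← mulOp_mul, mul_comm, mulOp_mul]

theorem mulOp_mul_eq_smul (f : RatFun N) (T : Module.End ℂ (RatFun N)) :
    mulOp f * T = f • T := rfl

theorem permOp_mul_apply (σ : Equiv.Perm (Fin N)) (f h : RatFun N) :
    permOp σ (f * h) = permOp σ f * permOp σ h :=
  map_mul (IsFractionRing.algEquivOfAlgEquiv (R := ℂ) (K := RatFun N) (L := RatFun N)
    (MvPolynomial.renameEquiv ℂ σ)) f h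

theorem permOp_inv_apply (σ : Equiv.Perm (Fin N)) (f : RatFun N) :
    permOp σ f⁻¹ = (permOp σ f)⁻¹ :=
  map_inv₀ (IsFractionRing.algEquivOfAlgEquiv (R := ℂ) (K := RatFun N) (L := RatFun N)
    (MvPolynomial.renameEquiv ℂ σ)) f

theorem permOp_one_apply (σ : Equiv.Perm (Fin N)) : permOp σ (1 : RatFun N) = 1 :=
  map_one (IsFractionRing.algEquivOfAlgEquiv (R := ℂ) (K := RatFun N) (L := RatFun N)
    (MvPolynomial.renameEquiv ℂ σ))

theorem permOp_algebraMap (σ : Equiv.Perm (Fin N)) (p : MvPolynomial (Fin N) ℂ) :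
    permOp σ (algebraMap _ (RatFun N) p) = algebraMap _ (RatFun N) (MvPolynomial.rename σ p) :=
  IsFractionRing.ringEquivOfRingEquiv_algebraMap
    (K := RatFun N) (L := RatFun N) (MvPolynomial.renameEquiv ℂ σ).toRingEquiv p

theorem permOp_coord (σ : Equiv.Perm (Fin N)) (i : Fin N) :
    permOp σ (coord i) = coord (σ i) := by
  rw [coord, permOp_algebraMap, MvPolynomial.rename_X]; rfl

theorem permOp_div_apply (σ : Equiv.Perm (Fin N)) (f h : RatFun N) :
    permOp σ (f / h) = permOp σ f / permOp σ h := by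
  rw [div_eq_mul_inv, permOp_mul_apply, permOp_inv_apply, div_eq_mul_inv]

theorem permOp_one : permOp (1 : Equiv.Perm (Fin N)) = 1 := by
  ext f
  obtain ⟨a, b, hb, rfl⟩ := exists_div f
  simp [permOp_div_apply, permOp_algebraMap]

theorem permOp_mul (σ τ : Equiv.Perm (Fin N)) : permOp (σ * τ) = permOp σ * permOp τ := by
  ext f
  obtain ⟨a, b, hb, rfl⟩ := exists_div f
  simp [permOp_div_apply, permOp_algebraMap, MvPolynomial.rename_rename]

theorem permOp_mul_mulOp (σ : Equiv.Perm (Fin N)) (f : RatFun N) :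
    permOp σ * mulOp f = mulOp (permOp σ f) * permOp σ := by
  ext h
  simp [mulOp_apply, permOp_mul_apply]

theorem partialOp_div (i : Fin N) (a b : MvPolynomial (Fin N) ℂ) (hb : b ≠ 0) :
    partialOp i (algebraMap _ (RatFun N) a / algebraMap _ (RatFun N) b) =
      algebraMap _ (RatFun N) (MvPolynomial.pderiv i a * b - a * MvPolynomial.pderiv i b) /
        algebraMap _ (RatFun N) b ^ 2 :=
  quotRule_div _ a b hb

theorem partialOp_algebraMap (i : Fin N) (p : MvPolynomial (Fin N) ℂ) :
    partialOp i (algebraMap _ (RatFun N) p) =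
      algebraMap _ (RatFun N) (MvPolynomial.pderiv i p) :=
  extendDerivation_algebraMap _ p

theorem partialOp_mul_apply (i : Fin N) (f h : RatFun N) :
    partialOp i (f * h) = f * partialOp i h + h * partialOp i f :=
  (extendDerivation (MvPolynomial.pderiv i)).leibniz f h

theorem partialOp_mul_mulOp (i : Fin N) (f : RatFun N) :
    partialOp i * mulOp f = mulOp f * partialOp i + mulOp (partialOp i f) := by
  ext h
  simp [mulOp_apply, partialOp_mul_apply, mul_comm]

theorem partialOp_coord (i j : Fin N) :
    partialOp i (coord j) = if i = j then 1 else 0 := by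
  rw [coord, partialOp_algebraMap, MvPolynomial.pderiv_X, Pi.single_apply]
  simp only [eq_comm (a := j)]
  split_ifs <;> simp

theorem permOp_mul_partialOp (σ : Equiv.Perm (Fin N)) (i : Fin N) :
    permOp σ * partialOp i = partialOp (σ i) * permOp σ := by
  ext f
  obtain ⟨a, b, hb, rfl⟩ := exists_div f
  have hb' : MvPolynomial.rename σ b ≠ 0 := by
    rwa [Ne, ← map_zero (MvPolynomial.rename σ),
      (MvPolynomial.rename_injective σ σ.injective).eq_iff]
  simp only [Module.End.mul_apply]
  rw [partialOp_div i a b hb, permOp_div_apply, permOp_div_apply, permOp_algebraMap,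
    permOp_algebraMap, permOp_algebraMap, partialOp_div _ _ _ hb', sq, sq, permOp_mul_apply,
    permOp_algebraMap]
  simp only [map_mul, map_sub, MvPolynomial.pderiv_rename σ.injective]

/-- The commutator is a derivation that kills all polynomials. Applying the Leibniz rule to `(a / b)
* b` shows that it kills quotients as well. -/
theorem partialOp_comm (i j : Fin N) :
    partialOp i * partialOp j = partialOp j * (partialOp i : Module.End ℂ (RatFun N)) := by
  let c := ⁅extendDerivation (MvPolynomial.pderiv (R := ℂ) i),
    extendDerivation (MvPolynomial.pderiv j)⁆
  have hc : ∀ p : MvPolynomial (Fin N) ℂ, c (algebraMap _ _ p) = 0 := fun p => by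
    rw [Derivation.commutator_apply, extendDerivation_algebraMap, extendDerivation_algebraMap,
      extendDerivation_algebraMap, extendDerivation_algebraMap, ← map_sub,
      ← Derivation.commutator_apply]
    have : ⁅MvPolynomial.pderiv (R := ℂ) i, MvPolynomial.pderiv j⁆ = 0 :=
      MvPolynomial.derivation_ext fun k => by
        classical
        rw [Derivation.commutator_apply, MvPolynomial.pderiv_X, MvPolynomial.pderiv_X,
          Pi.single_apply, Pi.single_apply]
        split_ifs <;> simp
    rw [this, Derivation.zero_apply, map_zero]
  ext f
  obtain ⟨a, b, hb, rfl⟩ := exists_div f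
  have hb' := algebraMap_ne hb
  have h := c.leibniz (algebraMap _ (RatFun N) a / algebraMap _ (RatFun N) b)
    (algebraMap _ (RatFun N) b)
  rw [div_mul_cancel₀ _ hb', hc, hc, smul_zero, zero_add, smul_eq_mul] at h
  have h' := (mul_eq_zero.1 h.symm).resolve_left hb'
  rw [Derivation.commutator_apply, sub_eq_zero] at h'
  exact h'

/-- The inverse of the difference of two coordinates. -/
def invDiff (a b : Fin N) : RatFun N := (coord a - coord b)⁻¹

theorem permOp_invDiff (σ : Equiv.Perm (Fin N)) (a b : Fin N) :
    permOp σ (invDiff a b) = invDiff (σ a) (σ b) := by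
  rw [invDiff, permOp_inv_apply, map_sub, permOp_coord, permOp_coord, invDiff]

/-- The convention `0⁻¹ = 0` makes the diagonal term vanish, so the sums in the Dunkl operators can
run over all indices and be reindexed by permutations. -/
theorem invDiff_self (a : Fin N) : invDiff a a = 0 := by simp [invDiff]

theorem invDiff_swap (a b : Fin N) : invDiff b a = - invDiff a b := by
  rw [invDiff, ← neg_sub (coord a)]
  exact inv_neg

theorem coord_injective : Function.Injective (coord : Fin N → RatFun N) := fun _ _ h =>
  MvPolynomial.X_injective (R := ℂ) (IsFractionRing.injective (MvPolynomial (Fin N) ℂ) (RatFun N) h)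

theorem invDiff_mul (a b : Fin N) (h : a ≠ b) : invDiff a b * (coord a - coord b) = 1 :=
  inv_mul_cancel₀ (sub_ne_zero.2 fun e => h (coord_injective e))

/-! ### Dunkl operators against permutations and coordinates. -/

theorem nabla_eq (g : ℂ) (i : Fin N) :
    nabla g i = partialOp i - g • ∑ j, mulOp (invDiff i j) * permOp (Equiv.swap i j) := by
  rw [nabla, ← Finset.add_sum_erase _ _ (Finset.mem_univ i), invDiff_self, mulOp_zero, zero_mul,
    zero_add, Finset.smul_sum]
  congr 1
  refine Finset.sum_congr rfl fun j _ => ?_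
  ext f
  simp [mulOp_apply, invDiff, div_eq_mul_inv, mul_assoc, Algebra.smul_def]

/-- The operator `S_{ij}`. -/
def SOp (g : ℂ) (i j : Fin N) : Module.End ℂ (RatFun N) :=
  if i = j then 1 + g • ∑ k ∈ Finset.univ.erase i, permOp (Equiv.swap i k)
  else (-g) • permOp (Equiv.swap i j)

theorem SOp_comm (g : ℂ) (i j : Fin N) : SOp g i j = SOp g j i := by
  rcases eq_or_ne i j with rfl | h
  · rfl
  · rw [SOp, SOp, if_neg h, if_neg h.symm, Equiv.swap_comm]

theorem permOp_mul_nabla (g : ℂ) (σ : Equiv.Perm (Fin N)) (i : Fin N) :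
    permOp σ * nabla g i = nabla g (σ i) * permOp σ := by
  rw [nabla_eq, nabla_eq, mul_sub, sub_mul, permOp_mul_partialOp]
  congr 1
  rw [mul_smul_comm, smul_mul_assoc, Finset.mul_sum, Finset.sum_mul,
    ← Equiv.sum_comp σ fun j => mulOp (invDiff (σ i) j) * permOp (Equiv.swap (σ i) j) * permOp σ]
  congr 1
  refine Finset.sum_congr rfl fun j _ => ?_
  rw [← mul_assoc, permOp_mul_mulOp, permOp_invDiff, mul_assoc, mul_assoc, ← permOp_mul,
    ← permOp_mul, Equiv.mul_swap_eq_swap_mul]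

/-- Moving `x_j` through `s_{ik}` leaves the divided difference `(x_{s_{ik} j} - x_j) / (x_i -
x_k)`, which is `-1`, `1` or `0` according as `j = i`, `j = k` or neither (for `k ≠ i`). The
reflection terms thus leave only permutations with constant coefficients. -/
theorem nabla_mul_coord (g : ℂ) (i j : Fin N) :
    nabla g i * mulOp (coord j) = mulOp (coord j) * nabla g i + SOp g i j := by
  have key : ∀ k, mulOp (invDiff i k) * permOp (Equiv.swap i k) * mulOp (coord j) =
      mulOp (coord j) * (mulOp (invDiff i k) * permOp (Equiv.swap i k)) +
      mulOp (invDiff i k * (coord (Equiv.swap i k j) - coord j)) * permOp (Equiv.swap i k) := by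
    intro k
    rw [mul_assoc, permOp_mul_mulOp, permOp_coord, mulOp_mul, mulOp_sub, mul_sub, sub_mul,
      ← mul_assoc, ← mul_assoc, mulOp_comm (coord j)]
    abel
  rw [nabla_eq, sub_mul, mul_sub, smul_mul_assoc, mul_smul_comm, Finset.sum_mul, Finset.mul_sum,
    partialOp_mul_mulOp, partialOp_coord, Finset.sum_congr rfl fun k _ => key k,
    Finset.sum_add_distrib, smul_add]
  have e : (SOp g i j : Module.End ℂ (RatFun N)) = mulOp (if i = j then 1 else 0) -
      g • ∑ k, mulOp (invDiff i k * (coord (Equiv.swap i k j) - coord j)) *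
        permOp (Equiv.swap i k) := by
    rcases eq_or_ne i j with rfl | h
    · rw [SOp, if_pos rfl, if_pos rfl, mulOp_one, ← Finset.add_sum_erase _ _ (Finset.mem_univ i),
        invDiff_self, zero_mul, mulOp_zero, zero_mul, zero_add, eq_sub_iff_add_eq, add_assoc,
        ← smul_add, ← Finset.sum_add_distrib, Finset.sum_eq_zero, smul_zero, add_zero]
      intro k hk
      rw [Equiv.swap_apply_left, ← neg_sub (coord i), mul_neg,
        invDiff_mul i k (Finset.ne_of_mem_erase hk).symm]
      ext f
      simp [mulOp_apply]
    · rw [SOp, if_neg h, if_neg h, mulOp_zero, Finset.sum_eq_single j,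
        Equiv.swap_apply_right, invDiff_mul i j h, mulOp_one, one_mul]
      · module
      · intro k _ hk
        rw [Equiv.swap_apply_of_ne_of_ne h.symm hk.symm, sub_self, mul_zero, mulOp_zero, zero_mul]
      · simp
  rw [e]
  abel

theorem permOp_mul_coord (σ : Equiv.Perm (Fin N)) (i : Fin N) :
    permOp σ * mulOp (coord i) = mulOp (coord (σ i)) * permOp σ := by
  rw [permOp_mul_mulOp, permOp_coord]

/-- An operator commuting with the coordinates is the multiplication by its value at `1`. -/
theorem eq_mulOp_of_commute (T : Module.End ℂ (RatFun N))
    (h : ∀ i, T * mulOp (coord i) = mulOp (coord i) * T) : T = mulOp (T 1) := by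
  have hp : ∀ (p : MvPolynomial (Fin N) ℂ) (f : RatFun N),
      T (algebraMap _ _ p * f) = algebraMap _ _ p * T f := by
    intro p
    induction p using MvPolynomial.induction_on with
    | C c =>
      intro f
      have e : algebraMap (MvPolynomial (Fin N) ℂ) (RatFun N) (MvPolynomial.C c) =
          algebraMap ℂ (RatFun N) c :=
        (IsScalarTower.algebraMap_apply ℂ (MvPolynomial (Fin N) ℂ) (RatFun N) c).symm
      rw [e, ← Algebra.smul_def, map_smul, Algebra.smul_def]
    | add p q hp hq => intro f; rw [map_add, add_mul, map_add, hp, hq, add_mul]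
    | mul_X p i hp =>
      intro f
      rw [map_mul (algebraMap _ _), mul_assoc, hp, mul_assoc]
      congr 1
      exact LinearMap.congr_fun (h i) f
  ext f
  obtain ⟨a, b, hb, rfl⟩ := exists_div f
  have hb' := algebraMap_ne hb
  -- Clearing the denominator reduces the claim to linearity over polynomials.
  apply mul_left_cancel₀ hb'
  rw [← hp, mul_div_cancel₀ _ hb', mulOp_apply, ← mul_one (algebraMap _ _ a), hp]
  field_simp

/-! ### Commutativity of the Dunkl operators. -/

theorem nabla_SOp_self (g : ℂ) {i j : Fin N} (h : i ≠ j) :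
    nabla g i * SOp g j j - SOp g j j * nabla g i =
      g • ((nabla g i - nabla g j) * permOp (Equiv.swap i j)) := by
  have e : nabla g i * (∑ k ∈ Finset.univ.erase j, permOp (Equiv.swap j k)) -
      (∑ k ∈ Finset.univ.erase j, permOp (Equiv.swap j k)) * nabla g i =
      (nabla g i - nabla g j) * permOp (Equiv.swap i j) := by
    rw [Finset.mul_sum, Finset.sum_mul, ← Finset.sum_sub_distrib, Finset.sum_eq_single i]
    · rw [permOp_mul_nabla, Equiv.swap_apply_right, sub_mul, Equiv.swap_comm]
    · intro k _ hk
      rw [permOp_mul_nabla, Equiv.swap_apply_of_ne_of_ne h hk.symm, sub_self]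
    · simp [h]
  rw [← e, SOp, if_pos rfl, mul_add, add_mul, mul_one, one_mul, mul_smul_comm, smul_mul_assoc,
    add_sub_add_left_eq_sub, smul_sub]

theorem nabla_SOp_of_ne (g : ℂ) {i j : Fin N} (h : i ≠ j) :
    nabla g j * SOp g i j - SOp g i j * nabla g j =
      g • ((nabla g i - nabla g j) * permOp (Equiv.swap i j)) := by
  rw [SOp, if_neg h, mul_smul_comm, smul_mul_assoc, permOp_mul_nabla, Equiv.swap_apply_right,
    sub_mul]
  module

/-- This is the obstruction to `[∇_i, ∇_j]` commuting with `x_k`, by the Jacobi identity. When `k`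
is neither `i` nor `j`, both sides vanish; when `k` is one of two distinct indices `i`, `j`, both
equal a multiple of `(∇_i - ∇_j) s_{ij}`. -/
theorem nabla_SOp (g : ℂ) (i j k : Fin N) :
    nabla g i * SOp g j k - SOp g j k * nabla g i =
      nabla g j * SOp g i k - SOp g i k * nabla g j := by
  rcases eq_or_ne i j with rfl | hij
  · rfl
  rcases eq_or_ne k j with rfl | hkj
  · rw [nabla_SOp_self g hij, nabla_SOp_of_ne g hij]
  rcases eq_or_ne k i with rfl | hki
  · rw [nabla_SOp_self g hkj.symm, nabla_SOp_of_ne g hkj.symm]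
  · have e : ∀ {a b : Fin N}, a ≠ b → k ≠ a → k ≠ b →
        nabla g a * SOp g b k - SOp g b k * nabla g a = 0 := by
      intro a b hab hka hkb
      rw [SOp, if_neg hkb.symm, mul_smul_comm, smul_mul_assoc,
        permOp_mul_nabla, Equiv.swap_apply_of_ne_of_ne hab hka.symm, sub_self]
    rw [e hij hki hkj, e hij.symm hkj hki]

theorem nabla_commutator_coord (g : ℂ) (i j k : Fin N) :
    (nabla g i * nabla g j - nabla g j * nabla g i) * mulOp (coord k) =
      mulOp (coord k) * (nabla g i * nabla g j - nabla g j * nabla g i) := by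
  have e : ∀ a b : Fin N, nabla g a * nabla g b * mulOp (coord k) =
      mulOp (coord k) * (nabla g a * nabla g b) + SOp g a k * nabla g b +
        nabla g a * SOp g b k := by
    intro a b
    rw [mul_assoc, nabla_mul_coord, mul_add, ← mul_assoc, nabla_mul_coord, add_mul, mul_assoc]
  have h := nabla_SOp g i j k
  rw [sub_eq_sub_iff_add_eq_add] at h
  rw [sub_mul, e, e, mul_sub, add_assoc, add_assoc, add_sub_add_comm, add_comm (SOp g i k * _), h,
    add_comm (SOp g j k * _), sub_self, add_zero]

theorem nabla_apply (g : ℂ) (i : Fin N) (f : RatFun N) :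
    nabla g i f = partialOp i f - g • ∑ j, invDiff i j * permOp (Equiv.swap i j) f := by
  rw [nabla_eq]
  simp [mulOp_apply]

theorem nabla_one (g : ℂ) (i : Fin N) : nabla g i 1 = -(g • ∑ k, invDiff i k) := by
  have h1 : partialOp i (1 : RatFun N) = 0 :=
    (extendDerivation (MvPolynomial.pderiv (R := ℂ) i)).map_one_eq_zero
  simp [nabla_apply, h1, permOp_one_apply]

theorem partialOp_invDiff {i j : Fin N} (h : i ≠ j) (k : Fin N) :
    partialOp i (invDiff j k) = if i = k then invDiff i j ^ 2 else 0 := by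
  rcases eq_or_ne j k with rfl | hjk
  · rw [invDiff_self, map_zero, if_neg h]
  have e := partialOp_mul_apply i (invDiff j k) (coord j - coord k)
  have hne : coord j - coord k ≠ (0 : RatFun N) := sub_ne_zero.2 fun e => hjk (coord_injective e)
  have h1 : partialOp i (1 : RatFun N) = 0 :=
    (extendDerivation (MvPolynomial.pderiv (R := ℂ) i)).map_one_eq_zero
  rw [invDiff_mul j k hjk, h1, map_sub, partialOp_coord, partialOp_coord, if_neg h] at e
  apply mul_left_cancel₀ hne
  split_ifs at e ⊢ with hik
  · subst hik
    have := invDiff_mul j i hjk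
    rw [invDiff_swap j i]
    linear_combination -e - invDiff j i * this
  · linear_combination -e

/-- Only the term `k = i` depends on `x_i`, which gives the square. In the reflection part `s_{il}`
moves `j` only for `l = j`, which gives the correction term. The result is symmetric in `i` and `j`,
since it contains a product of two antisymmetric factors. -/
theorem nabla_sum_invDiff (g : ℂ) {i j : Fin N} (h : i ≠ j) :
    nabla g i (∑ k, invDiff j k) = invDiff i j ^ 2 - g • ((∑ k, invDiff i k) * (∑ k, invDiff j k) +
      invDiff i j * (∑ k, invDiff i k - ∑ k, invDiff j k)) := by
  have e : ∀ l, permOp (Equiv.swap i l) (∑ k, invDiff j k) =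
      ∑ k, invDiff (Equiv.swap i l j) k := by
    intro l
    rw [map_sum, ← Equiv.sum_comp (Equiv.swap i l) fun k => invDiff (Equiv.swap i l j) k]
    exact Finset.sum_congr rfl fun k _ => permOp_invDiff _ _ _
  rw [nabla_apply, map_sum, Finset.sum_congr rfl fun k _ => partialOp_invDiff h k,
    Finset.sum_ite_eq, if_pos (Finset.mem_univ i), Finset.sum_congr rfl fun l _ => by rw [e l]]
  congr 2
  have e' : ∀ l, l ≠ j → invDiff i l * ∑ k, invDiff (Equiv.swap i l j) k =
      invDiff i l * ∑ k, invDiff j k := by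
    intro l hl
    rw [Equiv.swap_apply_of_ne_of_ne h.symm hl.symm]
  have h1 := Finset.add_sum_erase Finset.univ (fun l => invDiff i l) (Finset.mem_univ j)
  rw [← Finset.add_sum_erase _ _ (Finset.mem_univ j),
    Finset.sum_congr rfl fun l hl => e' l (Finset.ne_of_mem_erase hl), ← Finset.sum_mul,
    Equiv.swap_apply_right]
  linear_combination (∑ k, invDiff j k) * h1

theorem nabla_nabla_one (g : ℂ) (i j : Fin N) :
    nabla g i (nabla g j 1) = nabla g j (nabla g i 1) := by
  rcases eq_or_ne i j with rfl | h
  · rfl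
  rw [nabla_one, nabla_one, map_neg, map_neg, map_smul, map_smul, nabla_sum_invDiff g h,
    nabla_sum_invDiff g h.symm, invDiff_swap i j]
  simp only [Algebra.smul_def]
  ring

/-- The commutator commutes with all coordinates, so it is multiplication by its value at `1`, and
that value is zero. -/
theorem nabla_comm (g : ℂ) (i j : Fin N) : nabla g i * nabla g j = nabla g j * nabla g i := by
  rw [← sub_eq_zero, eq_mulOp_of_commute _ (nabla_commutator_coord g i j)]
  simp [nabla_nabla_one g i j, mulOp_zero]

/-! ### The crossing relations -/

/-- The operator `x_i + ∇_i`, a multiple of the annihilation operator. -/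
def lowerOp (g : ℂ) (i : Fin N) : Module.End ℂ (RatFun N) := mulOp (coord i) + nabla g i

/-- The operator `x_i - ∇_i`, a multiple of the creation operator. -/
def raiseOp (g : ℂ) (i : Fin N) : Module.End ℂ (RatFun N) := mulOp (coord i) - nabla g i

theorem lowerOp_comm (g : ℂ) (i j : Fin N) :
    lowerOp g i * lowerOp g j = lowerOp g j * lowerOp g i := by
  simp only [lowerOp, mul_add, add_mul]
  rw [nabla_mul_coord, nabla_mul_coord, nabla_comm g i j, mulOp_comm, SOp_comm g i j]
  abel

theorem raiseOp_comm (g : ℂ) (i j : Fin N) :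
    raiseOp g i * raiseOp g j = raiseOp g j * raiseOp g i := by
  simp only [raiseOp, mul_sub, sub_mul]
  rw [nabla_mul_coord, nabla_mul_coord, nabla_comm g i j, mulOp_comm, SOp_comm g i j]
  abel

theorem lowerOp_mul_coord (g : ℂ) (i j : Fin N) :
    lowerOp g i * mulOp (coord j) = mulOp (coord j) * lowerOp g i + SOp g i j := by
  rw [lowerOp, mul_add, add_mul, nabla_mul_coord, mulOp_comm]
  abel

theorem lowerOp_mul_raiseOp (g : ℂ) (i j : Fin N) :
    lowerOp g i * raiseOp g j = raiseOp g j * lowerOp g i + (2 : ℂ) • SOp g i j := by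
  rw [lowerOp, raiseOp, mul_sub, sub_mul, add_mul, add_mul, mul_add, mul_add, nabla_mul_coord,
    nabla_mul_coord, nabla_comm g i j, mulOp_comm, SOp_comm g j i, two_smul]
  abel

theorem permOp_mul_lowerOp (g : ℂ) (σ : Equiv.Perm (Fin N)) (i : Fin N) :
    permOp σ * lowerOp g i = lowerOp g (σ i) * permOp σ := by
  rw [lowerOp, mul_add, permOp_mul_coord, permOp_mul_nabla, lowerOp, add_mul]

theorem permOp_mul_raiseOp (g : ℂ) (σ : Equiv.Perm (Fin N)) (i : Fin N) :
    permOp σ * raiseOp g i = raiseOp g (σ i) * permOp σ := by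
  rw [raiseOp, mul_sub, permOp_mul_coord, permOp_mul_nabla, raiseOp, sub_mul]

theorem EOp_eq (g : ℂ) (k l : Fin N) : EOp g k l = (2⁻¹ : ℂ) • (raiseOp g k * lowerOp g l) := by
  have h : ((Real.sqrt 2 : ℂ) / 2) * ((Real.sqrt 2 : ℂ) / 2) = 2⁻¹ := by
    rw [div_mul_div_comm, ← Complex.ofReal_mul, Real.mul_self_sqrt zero_le_two]
    norm_num
  rw [EOp, creation, annihilation, smul_mul_smul_comm, h, raiseOp, lowerOp]

theorem permOp_mul_EOp (g : ℂ) (σ : Equiv.Perm (Fin N)) (k l : Fin N) :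
    permOp σ * EOp g k l = EOp g (σ k) (σ l) * permOp σ := by
  rw [EOp_eq, EOp_eq, mul_smul_comm, smul_mul_assoc, ← mul_assoc, permOp_mul_raiseOp, mul_assoc,
    permOp_mul_lowerOp, mul_assoc]

/-- Adding `S_{kl}` reverses the order of the raising and the lowering factor; the crossing
relations rest on this. -/
theorem EOp_add_SOp (g : ℂ) (k l : Fin N) :
    EOp g k l + SOp g k l = (2⁻¹ : ℂ) • (lowerOp g l * raiseOp g k) := by
  rw [lowerOp_mul_raiseOp, smul_add, smul_smul, EOp_eq, SOp_comm, inv_mul_cancel₀ two_ne_zero,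
    one_smul]

theorem EOp_mul_crossing (g : ℂ) (i j k l : Fin N) :
    EOp g i j * (EOp g k l + SOp g k l) = EOp g i l * (EOp g k j + SOp g k j) := by
  rw [EOp_add_SOp, EOp_add_SOp, EOp_eq, EOp_eq, smul_mul_smul_comm, smul_mul_smul_comm, mul_assoc,
    mul_assoc, ← mul_assoc (lowerOp g j), lowerOp_comm, mul_assoc]

theorem crossing_mul_EOp (g : ℂ) (i j k l : Fin N) :
    (EOp g i j + SOp g i j) * EOp g k l = (EOp g k j + SOp g k j) * EOp g i l := by
  rw [EOp_add_SOp, EOp_add_SOp, EOp_eq, EOp_eq, smul_mul_smul_comm, smul_mul_smul_comm, mul_assoc,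
    mul_assoc, ← mul_assoc (raiseOp g i), raiseOp_comm, mul_assoc]

end Operators

/-! ### Two criteria for linear independence -/

section LinearIndependence

/-- In a vanishing combination choose an index `k₀` of maximal degree in the support. The coordinate
at `e k₀` receives nothing from lower terms, by maximality, and nothing from other leading terms, by
injectivity of `e`. -/
theorem linearIndependent_of_triangular {R M ι κ : Type*} [Ring R] [AddCommGroup M] [Module R M]
    {b : ι → M} (hb : LinearIndependent R b) (deg : ι → ℕ) {e : κ → ι}
    (he : Function.Injective e) {b' : κ → M}
    (h : ∀ k, b' k - b (e k) ∈ Submodule.span R (b '' {i | deg i < deg (e k)})) :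
    LinearIndependent R b' := by
  classical
  rw [linearIndependent_iff]
  intro c hc
  by_contra hne
  obtain ⟨k₀, hk₀, hmax⟩ := Finset.exists_max_image c.support (fun k => deg (e k))
    (Finsupp.support_nonempty_iff.2 hne)
  have h' : ∀ k, ∃ d : ι →₀ R, (∀ i, deg (e k) ≤ deg i → d i = 0) ∧
      b' k = Finsupp.linearCombination R b (Finsupp.single (e k) 1 + d) := by
    intro k
    obtain ⟨d, hd, hd'⟩ := (Finsupp.mem_span_image_iff_linearCombination R).1 (h k)
    refine ⟨d, fun i hi => ?_, ?_⟩
    · by_contra hne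
      exact absurd (hd (Finsupp.mem_support_iff.2 hne)) (not_lt.2 hi)
    · rw [map_add, hd', Finsupp.linearCombination_single (R := R), one_smul, add_sub_cancel]
  choose d hd hd' using h'
  have hz : c.sum (fun k a => a • (Finsupp.single (e k) 1 + d k)) = 0 := by
    apply (linearIndependent_iff.1 hb)
    have hc' : ∑ k ∈ c.support, c k • b' k = 0 := by
      rw [← hc, Finsupp.linearCombination_apply, Finsupp.sum]
    rw [← hc', Finsupp.sum, map_sum]
    exact Finset.sum_congr rfl fun k _ => by rw [map_smul, ← hd']
  have hz' := DFunLike.congr_fun hz (e k₀)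
  rw [Finsupp.sum, Finsupp.finsetSum_apply, Finset.sum_eq_single k₀] at hz'
  · simp only [Finsupp.smul_apply, Finsupp.add_apply, Finsupp.single_eq_same, hd k₀ _ le_rfl,
      add_zero, smul_eq_mul, mul_one, Finsupp.zero_apply] at hz'
    exact (Finsupp.mem_support_iff.1 hk₀) hz'
  · intro k hk hkk
    rw [Finsupp.smul_apply, Finsupp.add_apply, hd k _ (hmax k hk),
      Finsupp.single_eq_of_ne (fun h => hkk (he h).symm), add_zero, smul_zero]
  · exact fun h => absurd hk₀ h

theorem linearIndependent_prod_of_iSupIndep {R M ι κ : Type*} [Ring R] [AddCommGroup M]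
    [Module R M] {p : κ → Submodule R M} (hp : iSupIndep p) {v : ι × κ → M}
    (hv : ∀ k, LinearIndependent R fun i => v (i, k)) (hm : ∀ i k, v (i, k) ∈ p k) :
    LinearIndependent R v := by
  classical
  rw [linearIndependent_iff'']
  rintro s c hc hs ⟨i, k⟩
  by_cases hik : (i, k) ∈ s
  swap
  · exact hc _ hik
  -- Enlarging the support to a rectangle lets the sum be grouped by the second index, one group in
  -- each `p k`.
  have hsub : s ⊆ s.image Prod.fst ×ˢ s.image Prod.snd := Finset.subset_product
  rw [Finset.sum_subset hsub fun x _ hx => by rw [hc x hx, zero_smul],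
    Finset.sum_product_right] at hs
  have h0 := (iSupIndep_iff_finsetSum_eq_zero_imp_eq_zero p).1 hp _ _
    (fun k _ => Submodule.sum_mem _ fun i _ => Submodule.smul_mem _ _ (hm i k)) hs k
    (Finset.mem_image_of_mem Prod.snd hik)
  exact linearIndependent_iff'.1 (hv k) _ _ h0 i (Finset.mem_image_of_mem Prod.fst hik)

end LinearIndependence

/-! ### Products over multisets of commuting elements -/

section MultisetProd

variable {α M : Type*} [Monoid M]

/-- The product of the elements `A i`, for `i` in the multiset `s`, in some order. -/
def multisetProd (A : α → M) (s : Multiset α) : M := (s.toList.map A).prod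

theorem multisetProd_coe {A : α → M} (h : ∀ i j, A i * A j = A j * A i) (l : List α) :
    multisetProd A l = (l.map A).prod := by
  refine List.Perm.prod_eq' ((Multiset.coe_eq_coe.1 (Multiset.coe_toList _)).map A) ?_
  rw [List.pairwise_map]
  exact List.pairwise_of_forall fun i j => h i j

theorem multisetProd_zero (A : α → M) : multisetProd A 0 = 1 := by simp [multisetProd]

theorem multisetProd_cons {A : α → M} (h : ∀ i j, A i * A j = A j * A i) (i : α)
    (s : Multiset α) : multisetProd A (i ::ₘ s) = A i * multisetProd A s := by
  induction s using Quot.inductionOn with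
  | h l =>
    change multisetProd A (i ::ₘ (l : Multiset α)) = A i * multisetProd A (l : Multiset α)
    rw [Multiset.cons_coe, multisetProd_coe h, multisetProd_coe h, List.map_cons, List.prod_cons]

theorem mul_multisetProd {A : α → M} (h : ∀ i j, A i * A j = A j * A i) (e : α → α) {x : M}
    (hx : ∀ i, x * A i = A (e i) * x) (s : Multiset α) :
    x * multisetProd A s = multisetProd A (s.map e) * x := by
  induction s using Multiset.induction with
  | empty => simp [multisetProd_zero]
  | cons i s ih =>
    rw [multisetProd_cons h, Multiset.map_cons, multisetProd_cons h, ← mul_assoc, hx, mul_assoc,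
      ih, mul_assoc]

end MultisetProd

/-! ### Linear independence of the operators `∂^s σ` over the rational functions -/

section Differential

variable {N : ℕ}

/-- The operator `∂^s σ`. -/
def diffOp (p : Multiset (Fin N) × Equiv.Perm (Fin N)) : Module.End ℂ (RatFun N) :=
  multisetProd partialOp p.1 * permOp p.2

theorem diffOp_cons (i : Fin N) (s : Multiset (Fin N)) (σ : Equiv.Perm (Fin N)) :
    diffOp (i ::ₘ s, σ) = partialOp i * diffOp (s, σ) := by
  rw [diffOp, diffOp, multisetProd_cons partialOp_comm, mul_assoc]

theorem permOp_mul_diffOp (ρ : Equiv.Perm (Fin N)) (s : Multiset (Fin N))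
    (σ : Equiv.Perm (Fin N)) :
    permOp ρ * diffOp (s, σ) = diffOp (s.map ρ, ρ * σ) := by
  rw [diffOp, diffOp, ← mul_assoc, mul_multisetProd partialOp_comm ρ (permOp_mul_partialOp ρ),
    mul_assoc, ← permOp_mul]

/-- Right multiplication by a coordinate. -/
def rightCoord (i : Fin N) : Module.End (RatFun N) (Module.End ℂ (RatFun N)) where
  toFun T := T * mulOp (coord i)
  map_add' S T := add_mul S T _
  map_smul' _ _ := rfl

theorem rightCoord_comm (i j : Fin N) :
    Commute (rightCoord i : Module.End (RatFun N) (Module.End ℂ (RatFun N))) (rightCoord j) := by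
  refine LinearMap.ext fun T => ?_
  change T * mulOp (coord j) * mulOp (coord i) = T * mulOp (coord i) * mulOp (coord j)
  rw [mul_assoc, mul_assoc, mulOp_comm]

/-- Left multiplication by `∂_j` is not linear over `ℂ(x)`: it commutes with right multiplication by
`x_i`, but passing it across the scalar `f` costs `∂_j f`. -/
theorem rightCoord_partialOp_mul (i j : Fin N) (f : RatFun N) (T : Module.End ℂ (RatFun N)) :
    (rightCoord i - f • (1 : Module.End (RatFun N) (Module.End ℂ (RatFun N)))) (partialOp j * T) =
      partialOp j * ((rightCoord i - f • (1 : Module.End (RatFun N) (Module.End ℂ (RatFun N)))) T) +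
        partialOp j f • T := by
  change partialOp j * T * mulOp (coord i) - mulOp f * (partialOp j * T) =
    partialOp j * (T * mulOp (coord i) - mulOp f * T) + mulOp (partialOp j f) * T
  rw [mul_sub, ← mul_assoc (partialOp j) (mulOp f), partialOp_mul_mulOp, add_mul, mul_assoc,
    mul_assoc]
  abel

theorem diffOp_mem_maxGenEigenspace (s : Multiset (Fin N)) (σ : Equiv.Perm (Fin N)) (i : Fin N) :
    diffOp (s, σ) ∈ (rightCoord i).maxGenEigenspace (coord (σ i)) := by
  set Q := rightCoord i - (coord (σ i) : RatFun N) •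
    (1 : Module.End (RatFun N) (Module.End ℂ (RatFun N))) with hQ
  -- Each derivative on the left raises the order of nilpotency of `Q` by at most one, because the
  -- error term is a scalar multiple of `T`.
  have key : ∀ (j : Fin N) (n : ℕ) (T : Module.End ℂ (RatFun N)), (Q ^ n) T = 0 →
      (Q ^ (n + 1)) (partialOp j * T) = 0 := by
    intro j n
    induction n with
    | zero =>
      intro T hT
      have : T = 0 := hT
      rw [this, mul_zero, map_zero]
    | succ n ih =>
      intro T hT
      rw [pow_succ, Module.End.mul_apply, hQ, rightCoord_partialOp_mul, ← hQ, map_add, map_smul,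
        hT, smul_zero, add_zero]
      apply ih
      rwa [pow_succ, Module.End.mul_apply] at hT
  rw [Module.End.mem_maxGenEigenspace]
  induction s using Multiset.induction with
  | empty =>
    refine ⟨1, ?_⟩
    rw [pow_one, diffOp, multisetProd_zero, one_mul]
    change permOp σ * mulOp (coord i) - mulOp (coord (σ i)) * permOp σ = 0
    rw [permOp_mul_coord, sub_self]
  | cons j s ih =>
    obtain ⟨n, hn⟩ := ih
    exact ⟨n + 1, by rw [diffOp_cons]; exact key j n _ hn⟩

theorem multisetProd_partialOp_monomial (γ : Fin N →₀ ℕ) (s : Multiset (Fin N)) :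
    ∃ c : ℂ, multisetProd partialOp s (algebraMap _ (RatFun N) (MvPolynomial.monomial γ (1 : ℂ))) =
      algebraMap _ (RatFun N) (MvPolynomial.monomial (γ - Multiset.toFinsupp s) c) ∧
      (c ≠ 0 ↔ Multiset.toFinsupp s ≤ γ) := by
  induction s using Multiset.induction with
  | empty => exact ⟨1, by simp [multisetProd_zero]⟩
  | cons i s ih =>
    obtain ⟨c, hc, hc'⟩ := ih
    refine ⟨c * ((γ - Multiset.toFinsupp s) i : ℕ), ?_, ?_⟩
    · rw [multisetProd_cons partialOp_comm, Module.End.mul_apply, hc, partialOp_algebraMap,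
        MvPolynomial.pderiv_monomial, ← Multiset.singleton_add, map_add,
        Multiset.toFinsupp_singleton, add_comm, tsub_add_eq_tsub_tsub]
    · rw [mul_ne_zero_iff, hc', Nat.cast_ne_zero, ← Multiset.singleton_add, map_add,
        Multiset.toFinsupp_singleton]
      simp only [Finsupp.le_def, Finsupp.add_apply, Finsupp.tsub_apply]
      constructor
      · rintro ⟨h1, h2⟩ k
        have := h1 k
        rcases eq_or_ne i k with rfl | h
        · rw [Finsupp.single_eq_same]; omega
        · rw [Finsupp.single_eq_of_ne h.symm]; omega
      · intro h
        refine ⟨fun k => (Nat.le_add_left _ _).trans (h k), ?_⟩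
        have := h i
        rw [Finsupp.single_eq_same] at this
        omega

theorem linearIndependent_multisetProd_partialOp :
    LinearIndependent (RatFun N)
      (multisetProd partialOp : Multiset (Fin N) → Module.End ℂ (RatFun N)) := by
  rw [linearIndependent_iff]
  intro c hc
  by_contra hne
  -- With `t` of minimal size in the support, the monomial `x^t` is annihilated by every other `∂^s`
  -- in the support: survival would need `s ≤ t`, hence `s = t`.
  obtain ⟨t, ht, hmin⟩ := Finset.exists_min_image c.support Multiset.card
    (Finsupp.support_nonempty_iff.2 hne)
  have h := LinearMap.congr_fun hc
    (algebraMap _ (RatFun N) (MvPolynomial.monomial (Multiset.toFinsupp t) (1 : ℂ)))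
  rw [Finsupp.linearCombination_apply, Finsupp.sum, LinearMap.sum_apply,
    Finset.sum_eq_single t] at h
  · obtain ⟨a, ha, ha'⟩ := multisetProd_partialOp_monomial (Multiset.toFinsupp t) t
    rw [LinearMap.smul_apply, ha, LinearMap.zero_apply, smul_eq_mul] at h
    rcases mul_eq_zero.1 h with h | h
    · exact Finsupp.mem_support_iff.1 ht h
    · refine algebraMap_ne ?_ h
      rw [Ne, MvPolynomial.monomial_eq_zero]
      exact ha'.2 le_rfl
  · intro s hs hst
    obtain ⟨a, ha, ha'⟩ := multisetProd_partialOp_monomial (Multiset.toFinsupp t) s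
    have h0 : a = 0 := by
      by_contra h0
      have hle := ha'.1 h0
      exact hst (Multiset.eq_of_le_of_card_le (Finsupp.orderIsoMultiset.symm.le_iff_le.1 hle)
        (hmin s hs))
    rw [LinearMap.smul_apply, ha, h0, MvPolynomial.monomial_zero, map_zero, smul_zero]
  · exact fun h => absurd ht h

/-- The operators with a given `σ` lie in one joint generalised eigenspace, with eigenvalues `x_{σ
i}`, and these tuples determine `σ`. Within one eigenspace, right multiplication by `σ⁻¹` is linear
over `ℂ(x)` and removes the permutation. -/
theorem linearIndependent_diffOp :
    LinearIndependent (RatFun N)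
      (diffOp : Multiset (Fin N) × Equiv.Perm (Fin N) → Module.End ℂ (RatFun N)) := by
  have hχ : Function.Injective fun (σ : Equiv.Perm (Fin N)) (i : Fin N) =>
      (coord (σ i) : RatFun N) := fun σ τ h =>
    Equiv.ext fun i => coord_injective (congrFun h i)
  refine linearIndependent_prod_of_iSupIndep
    ((Module.End.independent_iInf_maxGenEigenspace_of_forall_mapsTo
      (rightCoord : Fin N → Module.End (RatFun N) (Module.End ℂ (RatFun N)))
      fun i j φ => Module.End.mapsTo_maxGenEigenspace_of_comm (rightCoord_comm j i) φ).comp hχ)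
    (fun σ => ?_) fun s σ => (Submodule.mem_iInf _).2 fun i => diffOp_mem_maxGenEigenspace s σ i
  let r : Module.End ℂ (RatFun N) →ₗ[RatFun N] Module.End ℂ (RatFun N) :=
    { toFun := fun T => T * permOp σ⁻¹
      map_add' := fun S T => add_mul S T _
      map_smul' := fun _ _ => rfl }
  refine LinearIndependent.of_comp r ?_
  have : (r ∘ fun s => diffOp (s, σ)) = multisetProd partialOp := by
    funext s
    change multisetProd partialOp s * permOp σ * permOp σ⁻¹ = _
    rw [mul_assoc, ← permOp_mul, mul_inv_cancel, permOp_one, mul_one]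
  rw [this]
  exact linearIndependent_multisetProd_partialOp

end Differential

/-! ### Linear independence of the operators `x^s (x + ∇)^t σ` -/

section NormalForm

variable {N : ℕ}

/-- The span over the rational functions of the operators `∂^s σ` with `|s| < m`. -/
def diffLT (N m : ℕ) : Submodule (RatFun N) (Module.End ℂ (RatFun N)) :=
  Submodule.span (RatFun N) (diffOp '' {p | Multiset.card p.1 < m})

theorem diffOp_mem_diffLT {m : ℕ} {s : Multiset (Fin N)} (h : Multiset.card s < m)
    (σ : Equiv.Perm (Fin N)) : diffOp (s, σ) ∈ diffLT N m :=
  Submodule.subset_span ⟨(s, σ), h, rfl⟩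

theorem diffLT_mono {m n : ℕ} (h : m ≤ n) : diffLT N m ≤ diffLT N n :=
  Submodule.span_mono (Set.image_mono fun _ hp => lt_of_lt_of_le hp h)

theorem permOp_mul_mem_diffLT {m : ℕ} (ρ : Equiv.Perm (Fin N)) {T : Module.End ℂ (RatFun N)}
    (hT : T ∈ diffLT N m) : permOp ρ * T ∈ diffLT N m := by
  induction hT using Submodule.span_induction with
  | mem T hT =>
    obtain ⟨⟨s, σ⟩, hs, rfl⟩ := hT
    rw [permOp_mul_diffOp]
    exact diffOp_mem_diffLT (by rw [Multiset.card_map]; exact hs) _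
  | zero => rw [mul_zero]; exact zero_mem _
  | add S T _ _ hS hT => rw [mul_add]; exact add_mem hS hT
  | smul f T _ hT =>
    rw [← mulOp_mul_eq_smul, ← mul_assoc, permOp_mul_mulOp, mul_assoc]
    exact Submodule.smul_mem _ _ hT

theorem partialOp_mul_mem_diffLT {m : ℕ} (i : Fin N) {T : Module.End ℂ (RatFun N)}
    (hT : T ∈ diffLT N m) : partialOp i * T ∈ diffLT N (m + 1) := by
  induction hT using Submodule.span_induction with
  | mem T hT =>
    obtain ⟨⟨s, σ⟩, hs, rfl⟩ := hT
    rw [← diffOp_cons]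
    exact diffOp_mem_diffLT (by rw [Multiset.card_cons]; exact Nat.succ_lt_succ hs) _
  | zero => rw [mul_zero]; exact zero_mem _
  | add S T _ _ hS hT => rw [mul_add]; exact add_mem hS hT
  | smul f T hT' hT =>
    rw [← mulOp_mul_eq_smul, ← mul_assoc, partialOp_mul_mulOp, add_mul, mul_assoc]
    exact add_mem (Submodule.smul_mem _ _ hT)
      (Submodule.smul_mem _ _ (diffLT_mono (Nat.le_succ m) hT'))

/-- The terms of `x_i + ∇_i` other than `∂_i` are permutations with rational coefficients, and these
do not raise the order of differentiation. -/
theorem lowerOp_mul_sub_mem_diffLT {m : ℕ} (g : ℂ) (i : Fin N) {T : Module.End ℂ (RatFun N)}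
    (hT : T ∈ diffLT N m) : lowerOp g i * T - partialOp i * T ∈ diffLT N m := by
  have e : lowerOp g i * T - partialOp i * T = (coord i : RatFun N) • T -
      algebraMap ℂ (RatFun N) g •
        ∑ j, invDiff i j • (permOp (Equiv.swap i j) * T) := by
    rw [algebraMap_smul, lowerOp, nabla_eq, add_mul, sub_mul, smul_mul_assoc, Finset.sum_mul,
      ← mulOp_mul_eq_smul]
    simp only [mul_assoc, ← mulOp_mul_eq_smul]
    abel
  rw [e]
  exact sub_mem (Submodule.smul_mem _ _ hT) (Submodule.smul_mem _ _ (Submodule.sum_mem _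
    fun j _ => Submodule.smul_mem _ _ (permOp_mul_mem_diffLT _ hT)))

theorem multisetProd_lowerOp_sub_mem_diffLT (g : ℂ) (s : Multiset (Fin N))
    (σ : Equiv.Perm (Fin N)) :
    multisetProd (lowerOp g) s * permOp σ - diffOp (s, σ) ∈ diffLT N (Multiset.card s) := by
  induction s using Multiset.induction with
  | empty => rw [diffOp, multisetProd_zero, multisetProd_zero, sub_self]; exact zero_mem _
  | cons i s ih =>
    have h1 := partialOp_mul_mem_diffLT i ih
    have h2 := lowerOp_mul_sub_mem_diffLT g i
      (add_mem (diffLT_mono (Nat.le_succ _) ih) (diffOp_mem_diffLT (Nat.lt_succ_self _) σ))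
    rw [sub_add_cancel] at h2
    rw [diffOp_cons, multisetProd_cons (lowerOp_comm g), Multiset.card_cons, mul_assoc]
    rw [mul_sub] at h1
    have h3 := add_mem h2 h1
    rwa [sub_add_sub_cancel] at h3

theorem linearIndependent_lowerOp (g : ℂ) :
    LinearIndependent (RatFun N) fun p : Multiset (Fin N) × Equiv.Perm (Fin N) =>
      multisetProd (lowerOp g) p.1 * permOp p.2 :=
  linearIndependent_of_triangular linearIndependent_diffOp (fun p => Multiset.card p.1)
    Function.injective_id fun p => multisetProd_lowerOp_sub_mem_diffLT g p.1 p.2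

/-- The operator `x^s (x + ∇)^t σ`. -/
def normalOp (g : ℂ) (p : Multiset (Fin N) × Multiset (Fin N) × Equiv.Perm (Fin N)) :
    Module.End ℂ (RatFun N) :=
  multisetProd (fun i => mulOp (coord i)) p.1 * (multisetProd (lowerOp g) p.2.1 * permOp p.2.2)

theorem linearIndependent_coord :
    LinearIndependent ℂ (multisetProd coord : Multiset (Fin N) → RatFun N) := by
  let l : MvPolynomial (Fin N) ℂ →ₗ[ℂ] RatFun N :=
    (IsScalarTower.toAlgHom ℂ (MvPolynomial (Fin N) ℂ) (RatFun N)).toLinearMap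
  have hl : LinearMap.ker l = ⊥ := LinearMap.ker_eq_bot.2
    (IsFractionRing.injective (MvPolynomial (Fin N) ℂ) (RatFun N))
  have h := ((MvPolynomial.basisMonomials (Fin N) ℂ).linearIndependent.map' l hl).comp
    Multiset.toFinsupp Multiset.toFinsupp.injective
  suffices e : multisetProd coord =
      (l ∘ MvPolynomial.basisMonomials (Fin N) ℂ) ∘ Multiset.toFinsupp by rw [e]; exact h
  funext s
  induction s using Multiset.induction with
  | empty => simp [multisetProd_zero, l]
  | cons i s ih =>
    rw [multisetProd_cons fun i j => mul_comm _ _, ih]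
    simp only [Function.comp_apply, MvPolynomial.coe_basisMonomials]
    rw [← Multiset.singleton_add, map_add, Multiset.toFinsupp_singleton,
      ← one_mul (1 : ℂ), ← MvPolynomial.monomial_mul, one_mul]
    exact (map_mul (algebraMap (MvPolynomial (Fin N) ℂ) (RatFun N)) _ _).symm

theorem multisetProd_mulOp_coord (s : Multiset (Fin N)) :
    multisetProd (fun i => mulOp (coord i)) s = mulOp (multisetProd coord s : RatFun N) := by
  induction s using Multiset.induction with
  | empty => rw [multisetProd_zero, multisetProd_zero, mulOp_one]
  | cons i s ih =>
    rw [multisetProd_cons fun i j => mulOp_comm _ _, multisetProd_cons fun i j => mul_comm _ _,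
      mulOp_mul, ih]

/-- Keeping multiplications on the left makes `x^s` a scalar of the field. A family independent over
`ℂ`, inside `ℂ(x)`, times a family independent over `ℂ(x)` is independent over `ℂ`. -/
theorem linearIndependent_normalOp (g : ℂ) :
    LinearIndependent ℂ (normalOp g : Multiset (Fin N) × Multiset (Fin N) × Equiv.Perm (Fin N) →
      Module.End ℂ (RatFun N)) := by
  convert linearIndependent_smul linearIndependent_coord (linearIndependent_lowerOp (N := N) g)
    using 1
  funext p
  rw [normalOp, multisetProd_mulOp_coord, mulOp_mul_eq_smul]

/-! ### Leading terms of the products of the operators `E_{ij}` -/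

/-- The span of the operators `x^s (x + ∇)^t σ` with `|s| < m`. -/
def normalLT (N : ℕ) (g : ℂ) (m : ℕ) : Submodule ℂ (Module.End ℂ (RatFun N)) :=
  Submodule.span ℂ (normalOp g '' {p | Multiset.card p.1 < m})

variable {g : ℂ}

theorem normalOp_mem_normalLT {m : ℕ} {s : Multiset (Fin N)} (h : Multiset.card s < m)
    (t : Multiset (Fin N)) (σ : Equiv.Perm (Fin N)) : normalOp g (s, t, σ) ∈ normalLT N g m :=
  Submodule.subset_span ⟨(s, t, σ), h, rfl⟩

theorem normalLT_mono {m n : ℕ} (h : m ≤ n) : normalLT N g m ≤ normalLT N g n :=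
  Submodule.span_mono (Set.image_mono fun _ hp => lt_of_lt_of_le hp h)

/-- To show that left multiplication by an operator maps `normalLT N g m` to `p`, it suffices to
consider the operators that span `normalLT N g m`. -/
theorem mul_mem_of_normalLT {m : ℕ} {p : Submodule ℂ (Module.End ℂ (RatFun N))}
    {A : Module.End ℂ (RatFun N)}
    (h : ∀ s t σ, Multiset.card s < m → A * normalOp g (s, t, σ) ∈ p)
    {T : Module.End ℂ (RatFun N)} (hT : T ∈ normalLT N g m) : A * T ∈ p := by
  have : normalLT N g m ≤ p.comap (LinearMap.mulLeft ℂ A) := by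
    refine Submodule.span_le.2 ?_
    rintro _ ⟨⟨s, t, σ⟩, hs, rfl⟩
    exact h s t σ hs
  exact this hT

theorem coord_mul_normalOp (i : Fin N) (s t : Multiset (Fin N)) (σ : Equiv.Perm (Fin N)) :
    mulOp (coord i) * normalOp g (s, t, σ) = normalOp g (i ::ₘ s, t, σ) := by
  rw [normalOp, normalOp, multisetProd_cons fun i j => mulOp_comm _ _, mul_assoc]

theorem coord_mul_mem_normalLT {m : ℕ} (i : Fin N) {T : Module.End ℂ (RatFun N)}
    (hT : T ∈ normalLT N g m) : mulOp (coord i) * T ∈ normalLT N g (m + 1) :=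
  mul_mem_of_normalLT (fun s t σ hs => by
    rw [coord_mul_normalOp]
    exact normalOp_mem_normalLT (by rw [Multiset.card_cons]; exact Nat.succ_lt_succ hs) t σ) hT

theorem permOp_mul_normalOp (ρ : Equiv.Perm (Fin N)) (s t : Multiset (Fin N))
    (σ : Equiv.Perm (Fin N)) :
    permOp ρ * normalOp g (s, t, σ) = normalOp g (s.map ρ, t.map ρ, ρ * σ) := by
  rw [normalOp, normalOp, ← mul_assoc, mul_multisetProd (fun i j => mulOp_comm _ _) ρ
    (permOp_mul_coord ρ), mul_assoc, ← mul_assoc (permOp ρ),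
    mul_multisetProd (lowerOp_comm g) ρ (permOp_mul_lowerOp g ρ), permOp_mul, mul_assoc]

theorem permOp_mul_mem_normalLT {m : ℕ} (ρ : Equiv.Perm (Fin N)) {T : Module.End ℂ (RatFun N)}
    (hT : T ∈ normalLT N g m) : permOp ρ * T ∈ normalLT N g m :=
  mul_mem_of_normalLT (fun s t σ hs => by
    rw [permOp_mul_normalOp]
    exact normalOp_mem_normalLT (by rwa [Multiset.card_map]) _ _) hT

theorem SOp_mul_mem_normalLT {m : ℕ} (i j : Fin N) {T : Module.End ℂ (RatFun N)}
    (hT : T ∈ normalLT N g m) : SOp g i j * T ∈ normalLT N g m := by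
  rw [SOp]
  split_ifs
  · rw [add_mul, one_mul, smul_mul_assoc, Finset.sum_mul]
    exact add_mem hT (Submodule.smul_mem _ _ (Submodule.sum_mem _ fun k _ =>
      permOp_mul_mem_normalLT _ hT))
  · rw [smul_mul_assoc]
    exact Submodule.smul_mem _ _ (permOp_mul_mem_normalLT _ hT)

/-- Each passage of `x_i + ∇_i` through some `x_j` leaves `S_{ij}` in place of one factor `x`.
Permutations keep the number of remaining factors. -/
theorem lowerOp_mul_normalOp (i : Fin N) (s t : Multiset (Fin N)) (σ : Equiv.Perm (Fin N)) :
    lowerOp g i * normalOp g (s, t, σ) - normalOp g (s, i ::ₘ t, σ) ∈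
      normalLT N g (Multiset.card s) := by
  induction s using Multiset.induction with
  | empty =>
    rw [normalOp, normalOp, multisetProd_cons (lowerOp_comm g), multisetProd_zero, one_mul,
      one_mul, mul_assoc, sub_self]
    exact zero_mem _
  | cons j s ih =>
    rw [← coord_mul_normalOp, ← coord_mul_normalOp, ← mul_assoc, lowerOp_mul_coord, add_mul,
      mul_assoc, add_sub_right_comm, ← mul_sub, Multiset.card_cons]
    exact add_mem (coord_mul_mem_normalLT j ih)
      (SOp_mul_mem_normalLT i j (normalOp_mem_normalLT (Nat.lt_succ_self _) t σ))

theorem lowerOp_mul_mem_normalLT {m : ℕ} (i : Fin N) {T : Module.End ℂ (RatFun N)}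
    (hT : T ∈ normalLT N g m) : lowerOp g i * T ∈ normalLT N g m :=
  mul_mem_of_normalLT (fun s t σ hs => by
    rw [← sub_add_cancel (lowerOp g i * _) (normalOp g (s, i ::ₘ t, σ))]
    exact add_mem (normalLT_mono hs.le (lowerOp_mul_normalOp i s t σ))
      (normalOp_mem_normalLT hs _ σ)) hT

theorem EOp_eq_sub (i j : Fin N) : EOp g i j =
    mulOp (coord i) * lowerOp g j - (2⁻¹ : ℂ) • (lowerOp g i * lowerOp g j) := by
  have e : raiseOp g i = (2 : ℂ) • mulOp (coord i) - lowerOp g i := by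
    rw [raiseOp, lowerOp]
    module
  rw [EOp_eq, e, sub_mul, smul_mul_assoc]
  module

/-- The product `E_{i_1 j_1} … E_{i_n j_n} σ` has the leading term
`x_{i_1} … x_{i_n} (x + ∇)_{j_1} … (x + ∇)_{j_n} σ`. -/
theorem prod_EOp_sub_mem_normalLT (L : List (Fin N × Fin N)) (σ : Equiv.Perm (Fin N)) :
    (L.map fun p => EOp g p.1 p.2).prod * permOp σ -
      normalOp g (↑(L.map Prod.fst), ↑(L.map Prod.snd), σ) ∈ normalLT N g L.length := by
  induction L with
  | nil =>
    simp only [List.map_nil, List.prod_nil, Multiset.coe_nil, normalOp, multisetProd_zero, one_mul,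
      sub_self]
    exact zero_mem _
  | cons p L ih =>
    obtain ⟨i, j⟩ := p
    simp only [List.map_cons, List.prod_cons, List.length_cons, mul_assoc, ← Multiset.cons_coe]
    set T := (L.map fun p => EOp g p.1 p.2).prod * permOp σ with hT
    set s : Multiset (Fin N) := ↑(L.map Prod.fst)
    set t : Multiset (Fin N) := ↑(L.map Prod.snd)
    have hs : Multiset.card s = L.length := by simp [s]
    have hTm : T ∈ normalLT N g (L.length + 1) := by
      rw [← sub_add_cancel T (normalOp g (s, t, σ))]
      exact add_mem (normalLT_mono (Nat.le_succ _) ih)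
        (normalOp_mem_normalLT (by rw [hs]; exact Nat.lt_succ_self _) _ _)
    have h1 : lowerOp g j * T - normalOp g (s, j ::ₘ t, σ) ∈ normalLT N g L.length := by
      have h := add_mem (lowerOp_mul_mem_normalLT j ih)
        (hs ▸ lowerOp_mul_normalOp (g := g) j s t σ)
      rwa [mul_sub, sub_add_sub_cancel] at h
    have h2 := coord_mul_mem_normalLT i h1
    rw [mul_sub, coord_mul_normalOp] at h2
    -- The term with two lowering operators adds no factor `x`, so it falls below the leading term,
    -- although it has the same total number of factors.
    rw [EOp_eq_sub, sub_mul, smul_mul_assoc, mul_assoc, mul_assoc, sub_right_comm]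
    exact sub_mem h2 (Submodule.smul_mem _ _
      (lowerOp_mul_mem_normalLT i (lowerOp_mul_mem_normalLT j hTm)))

end NormalForm

/-! ### A criterion for the Poincaré–Birkhoff–Witt property -/

section PBWCriterion

variable {T : Type*} [Ring T] [Algebra ℂ T]

theorem relProj_eq_zero_of_mem {P : Set T} {p : T} (hp : p ∈ P) : relProj P p = 0 := by
  rw [← map_zero (relProj P)]
  exact RingQuot.mkAlgHom_rel ℂ ⟨hp, rfl⟩

/-- An element of the kernel of the quotient map lies in every two-sided ideal containing the
relations. -/
theorem mem_of_relProj_eq_zero {P : Set T} {J : Submodule ℂ T} (hP : P ⊆ J)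
    (hl : ∀ x y, y ∈ J → x * y ∈ J) (hr : ∀ x y, x ∈ J → x * y ∈ J) {x : T}
    (hx : relProj P x = 0) : x ∈ J := by
  let I : TwoSidedIdeal T := TwoSidedIdeal.mk' J J.zero_mem J.add_mem J.neg_mem
    (fun {x y} h => hl x y h) (fun {x y} h => hr x y h)
  have hI : ∀ {y}, y ∈ I ↔ y ∈ J := TwoSidedIdeal.mem_mk' _ _ _ _ _ _ _
  let f : RelQuot P →+* I.ringCon.Quotient := RingQuot.lift ⟨I.ringCon.mk', by
    rintro y z ⟨hy, rfl⟩
    exact (RingCon.eq _).2 (TwoSidedIdeal.mem_iff _ _ |>.1 (hI.2 (hP hy)))⟩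
  have hf : f (relProj P x) = I.ringCon.mk' x := by
    have e : relProj P x = RingQuot.mkRingHom _ x :=
      RingHom.congr_fun (RingQuot.mkAlgHom_coe ℂ (fun x y : T => x ∈ P ∧ y = 0)) x
    rw [e]
    exact RingQuot.lift_mkRingHom_apply _ _ _
  rw [hx, map_zero] at hf
  exact hI.1 ((TwoSidedIdeal.mem_iff _ _).2 ((RingCon.eq _).1 hf.symm))

variable {𝒯 : ℕ → Submodule ℂ T} {P : Set T}

theorem map_relProj_le_filtLT {m n : ℕ} (h : m < n) :
    (𝒯 m).map (relProj P).toLinearMap ≤ filtLT 𝒯 P n :=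
  le_iSup₂ (f := fun m (_ : m < n) => (𝒯 m).map (relProj P).toLinearMap) m h

theorem relProj_mem_filtLT {m n : ℕ} (h : m < n) {x : T} (hx : x ∈ 𝒯 m) :
    relProj P x ∈ filtLT 𝒯 P n :=
  map_relProj_le_filtLT h (Submodule.mem_map_of_mem (f := (relProj P).toLinearMap) hx)

theorem filtLT_le {n : ℕ} {S : Submodule ℂ (RelQuot P)}
    (h : ∀ m < n, ∀ x ∈ 𝒯 m, relProj P x ∈ S) : filtLT 𝒯 P n ≤ S :=
  iSup₂_le fun m hm => Submodule.map_le_iff_le_comap.2 fun x hx => h m hm x hx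

theorem filtLT_mono {m n : ℕ} (h : m ≤ n) : filtLT 𝒯 P m ≤ filtLT 𝒯 P n :=
  filtLT_le fun _ hk _ hx => relProj_mem_filtLT (hk.trans_le h) hx

theorem filtLE_eq_sup (n : ℕ) :
    filtLE 𝒯 P n = (𝒯 n).map (relProj P).toLinearMap ⊔ filtLT 𝒯 P n := by
  apply le_antisymm
  · refine iSup₂_le fun m hm => ?_
    rcases hm.eq_or_lt with rfl | hm
    · exact le_sup_left
    · exact (map_relProj_le_filtLT hm).trans le_sup_right
  · refine sup_le (le_iSup₂ (f := fun m (_ : m ≤ n) => (𝒯 m).map (relProj P).toLinearMap) n le_rfl)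
      (filtLT_le fun m hm x hx => ?_)
    exact (le_iSup₂ (f := fun m (_ : m ≤ n) => (𝒯 m).map (relProj P).toLinearMap) m hm.le)
      (Submodule.mem_map_of_mem (f := (relProj P).toLinearMap) hx)

/-- If `x` has degree `n` and vanishes in the homogeneous quadratic algebra, then it has degree less
than `n` in the filtered algebra. -/
theorem relProj_mem_filtLT_of_relProj_quadraticPart_eq_zero
    (hmul : ∀ {m n : ℕ} {x y : T}, x ∈ 𝒯 m → y ∈ 𝒯 n → x * y ∈ 𝒯 (m + n))
    (htop : ⨆ n, 𝒯 n = ⊤) (π : ℕ → T →ₗ[ℂ] T) (hπ : ∀ n, ∀ x ∈ 𝒯 n, π n x = x)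
    (hπ' : ∀ m n, m ≠ n → ∀ x ∈ 𝒯 m, π n x = 0) {n : ℕ} {x : T} (hx : x ∈ 𝒯 n)
    (h : relProj (quadraticPart 𝒯 P) x = 0) : relProj P x ∈ filtLT 𝒯 P n := by
  -- The homogeneous elements whose images drop in filtration span a two-sided ideal `J`. It
  -- contains the quadratic parts, hence the whole kernel of the projection to the quadratic
  -- algebra.
  let K : ℕ → Submodule ℂ T := fun k => 𝒯 k ⊓ (filtLT 𝒯 P k).comap (relProj P).toLinearMap
  let J : Submodule ℂ T := ⨆ k, K k
  have hl : ∀ {m k : ℕ} {y z : T}, y ∈ 𝒯 m → z ∈ K k → y * z ∈ K (m + k) := by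
    intro m k y z hy hz
    refine ⟨hmul hy hz.1, ?_⟩
    have : filtLT 𝒯 P k ≤ (filtLT 𝒯 P (m + k)).comap (LinearMap.mulLeft ℂ (relProj P y)) :=
      filtLT_le fun i hi u hu => by
        change relProj P y * relProj P u ∈ filtLT 𝒯 P (m + k)
        rw [← map_mul]
        exact relProj_mem_filtLT (Nat.add_lt_add_left hi m) (hmul hy hu)
    change relProj P (y * z) ∈ filtLT 𝒯 P (m + k)
    rw [map_mul]
    exact this hz.2
  have hr : ∀ {m k : ℕ} {y z : T}, y ∈ 𝒯 m → z ∈ K k → z * y ∈ K (k + m) := by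
    intro m k y z hy hz
    refine ⟨hmul hz.1 hy, ?_⟩
    have : filtLT 𝒯 P k ≤ (filtLT 𝒯 P (k + m)).comap (LinearMap.mulRight ℂ (relProj P y)) :=
      filtLT_le fun i hi u hu => by
        change relProj P u * relProj P y ∈ filtLT 𝒯 P (k + m)
        rw [← map_mul]
        exact relProj_mem_filtLT (Nat.add_lt_add_right hi m) (hmul hu hy)
    change relProj P (z * y) ∈ filtLT 𝒯 P (k + m)
    rw [map_mul]
    exact this hz.2
  have hJl : ∀ y z, z ∈ J → y * z ∈ J := by
    intro y z hz
    have h1 : (⨆ m, 𝒯 m) ≤ J.comap (LinearMap.mulRight ℂ z) := iSup_le fun m u hu => by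
      have h2 : J ≤ J.comap (LinearMap.mulLeft ℂ u) := iSup_le fun k v hv =>
        le_iSup K (m + k) (hl hu hv)
      exact h2 hz
    rw [htop] at h1
    exact h1 (Submodule.mem_top (x := y))
  have hJr : ∀ z y, z ∈ J → z * y ∈ J := by
    intro z y hz
    have h1 : (⨆ m, 𝒯 m) ≤ J.comap (LinearMap.mulLeft ℂ z) := iSup_le fun m u hu => by
      have h2 : J ≤ J.comap (LinearMap.mulRight ℂ u) := iSup_le fun k v hv =>
        le_iSup K (k + m) (hr hu hv)
      exact h2 hz
    rw [htop] at h1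
    exact h1 (Submodule.mem_top (x := y))
  have hP : quadraticPart 𝒯 P ⊆ J := by
    rintro r ⟨hr2, p, hp, hpr⟩
    refine le_iSup K 2 ⟨hr2, ?_⟩
    have h01 : 𝒯 0 ⊔ 𝒯 1 ≤ (filtLT 𝒯 P 2).comap (relProj P).toLinearMap :=
      sup_le (fun u hu => relProj_mem_filtLT Nat.zero_lt_two hu)
        fun u hu => relProj_mem_filtLT Nat.one_lt_two hu
    -- The full relation `p` maps to zero, so its quadratic part equals minus its terms of lower
    -- degree.
    have e : relProj P r = -relProj P (p - r) := by
      rw [map_sub, relProj_eq_zero_of_mem hp, zero_sub, neg_neg]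
    change relProj P r ∈ filtLT 𝒯 P 2
    rw [e]
    exact neg_mem (h01 hpr)
  have hxJ := mem_of_relProj_eq_zero hP hJl hJr h
  -- Since `J` is built from homogeneous pieces, projecting to degree `n` shows that `x` itself lies
  -- in `K n`.
  have hJπ : J ≤ (K n).comap (π n) := iSup_le fun k u hu => by
    change π n u ∈ K n
    rcases eq_or_ne k n with rfl | hk
    · rwa [hπ k u hu.1]
    · rw [hπ' k n hk u hu.1]
      exact zero_mem _
  have := (hJπ hxJ).2
  rwa [hπ n x hx] at this

/-! ### Spanning families and the comparison of graded pieces. -/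

variable {ι : Type*} {w : ι → T} {deg : ι → ℕ}

theorem exists_mem_span_of_mem (hspan : ∀ n, ∀ x ∈ 𝒯 n, relProj (quadraticPart 𝒯 P) x ∈
      Submodule.span ℂ ((fun i => relProj (quadraticPart 𝒯 P) (w i)) '' {i | deg i = n}))
    {n : ℕ} {x : T} (hx : x ∈ 𝒯 n) : ∃ y ∈ Submodule.span ℂ (w '' {i | deg i = n}),
      relProj (quadraticPart 𝒯 P) x = relProj (quadraticPart 𝒯 P) y := by
  have h := hspan n x hx
  rw [← Set.image_image (relProj (quadraticPart 𝒯 P)) w] at h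
  have e := Submodule.map_span (relProj (quadraticPart 𝒯 P)).toLinearMap (w '' {i | deg i = n})
  obtain ⟨y, hy, hy'⟩ := e.ge h
  exact ⟨y, hy, hy'.symm⟩

theorem relProj_mem_span_image {s : Set ι} {y : T} (hy : y ∈ Submodule.span ℂ (w '' s)) :
    relProj P y ∈ Submodule.span ℂ ((fun i => relProj P (w i)) '' s) := by
  rw [← Set.image_image (relProj P) w]
  have e := Submodule.map_span (relProj P).toLinearMap (w '' s)
  exact e.le (Submodule.mem_map_of_mem hy)

/-- An element of degree `m` agrees in the quadratic algebra with a combination of the `w i` of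
degree `m`. Their difference drops in filtration and is covered by induction. -/
theorem filtLT_le_span (hw : ∀ i, w i ∈ 𝒯 (deg i))
    (hkey : ∀ n, ∀ x ∈ 𝒯 n, relProj (quadraticPart 𝒯 P) x = 0 → relProj P x ∈ filtLT 𝒯 P n)
    (hspan : ∀ n, ∀ x ∈ 𝒯 n, relProj (quadraticPart 𝒯 P) x ∈
      Submodule.span ℂ ((fun i => relProj (quadraticPart 𝒯 P) (w i)) '' {i | deg i = n}))
    (n : ℕ) : filtLT 𝒯 P n ≤
      Submodule.span ℂ ((fun i => relProj P (w i)) '' {i | deg i < n}) := by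
  induction n with
  | zero => exact filtLT_le fun m hm => absurd hm (Nat.not_lt_zero m)
  | succ n ih =>
    refine filtLT_le fun m hm x hx => ?_
    have hmn := Nat.le_of_lt_succ hm
    obtain ⟨y, hy, hxy⟩ := exists_mem_span_of_mem hspan hx
    have hy' : y ∈ 𝒯 m := Submodule.span_le.2 (by rintro _ ⟨i, rfl, rfl⟩; exact hw i) hy
    have h := filtLT_mono hmn (hkey m (x - y) (sub_mem hx hy') (by rw [map_sub, hxy, sub_self]))
    rw [← sub_add_cancel x y, map_add]
    refine add_mem (Submodule.span_mono (Set.image_mono fun i (hi : deg i < n) => ?_) (ih h))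
      (Submodule.span_mono (Set.image_mono fun i (hi : deg i = m) => ?_)
        (relProj_mem_span_image hy))
    · exact Nat.lt_succ_of_lt hi
    · exact hi.trans_lt hm

theorem span_relProj_eq_top (htop : ⨆ n, 𝒯 n = ⊤) (hw : ∀ i, w i ∈ 𝒯 (deg i))
    (hkey : ∀ n, ∀ x ∈ 𝒯 n, relProj (quadraticPart 𝒯 P) x = 0 → relProj P x ∈ filtLT 𝒯 P n)
    (hspan : ∀ n, ∀ x ∈ 𝒯 n, relProj (quadraticPart 𝒯 P) x ∈
      Submodule.span ℂ ((fun i => relProj (quadraticPart 𝒯 P) (w i)) '' {i | deg i = n})) :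
    Submodule.span ℂ (Set.range fun i => relProj P (w i)) = ⊤ := by
  rw [eq_top_iff]
  intro z _
  obtain ⟨x, rfl⟩ := RingQuot.mkAlgHom_surjective ℂ (fun x y : T => x ∈ P ∧ y = 0) z
  have h : (⨆ n, 𝒯 n) ≤ (Submodule.span ℂ (Set.range fun i => relProj P (w i))).comap
      (relProj P).toLinearMap := iSup_le fun n x hx =>
    Submodule.span_mono (Set.image_subset_range _ _)
      (filtLT_le_span hw hkey hspan (n + 1) (relProj_mem_filtLT (Nat.lt_succ_self n) hx))
  rw [htop] at h
  exact h (Submodule.mem_top (x := x))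

/-- The Poincaré–Birkhoff–Witt property holds if some homogeneous elements span the homogeneous
quadratic algebra and are linearly independent in the filtered algebra. -/
theorem gradedIso_of_linearIndependent (hw : ∀ i, w i ∈ 𝒯 (deg i))
    (hkey : ∀ n, ∀ x ∈ 𝒯 n, relProj (quadraticPart 𝒯 P) x = 0 → relProj P x ∈ filtLT 𝒯 P n)
    (hspan : ∀ n, ∀ x ∈ 𝒯 n, relProj (quadraticPart 𝒯 P) x ∈
      Submodule.span ℂ ((fun i => relProj (quadraticPart 𝒯 P) (w i)) '' {i | deg i = n}))
    (hli : LinearIndependent ℂ fun i => relProj P (w i)) (n : ℕ) :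
    ∃ e : quadraticPiece 𝒯 P n ≃ₗ[ℂ] gradedPiece 𝒯 P n,
      ∀ (x : T) (hx : x ∈ 𝒯 n),
        e ⟨relProj (quadraticPart 𝒯 P) x, relProj_mem_quadraticPiece 𝒯 P hx⟩ =
          Submodule.Quotient.mk ⟨relProj P x, relProj_mem_filtLE 𝒯 P hx⟩ := by
  let q : 𝒯 n →ₗ[ℂ] quadraticPiece 𝒯 P n :=
    ((relProj (quadraticPart 𝒯 P)).toLinearMap.comp (𝒯 n).subtype).codRestrict _
      fun x => relProj_mem_quadraticPiece 𝒯 P x.2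
  let h : 𝒯 n →ₗ[ℂ] gradedPiece 𝒯 P n := (Submodule.mkQ _).comp
    (((relProj P).toLinearMap.comp (𝒯 n).subtype).codRestrict (filtLE 𝒯 P n)
      fun x => relProj_mem_filtLE 𝒯 P x.2)
  have hq : Function.Surjective q := by
    rintro ⟨_, x, hx, rfl⟩
    exact ⟨⟨x, hx⟩, rfl⟩
  have hh : Function.Surjective h := by
    intro z
    obtain ⟨⟨z, hz⟩, rfl⟩ := Submodule.Quotient.mk_surjective _ z
    obtain ⟨_, ⟨x, hx, rfl⟩, v, hv, hxv⟩ := Submodule.mem_sup.1 ((filtLE_eq_sup n).le hz)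
    refine ⟨⟨x, hx⟩, (Submodule.Quotient.eq _).2 ?_⟩
    change relProj P x - z ∈ filtLT 𝒯 P n
    rw [← hxv, sub_add_eq_sub_sub]
    simpa using hv
  have hqk : ∀ x : 𝒯 n, q x = 0 ↔ relProj (quadraticPart 𝒯 P) (x : T) = 0 := fun x =>
    Subtype.ext_iff
  have hhk : ∀ x : 𝒯 n, h x = 0 ↔ relProj P (x : T) ∈ filtLT 𝒯 P n := fun x =>
    Submodule.Quotient.mk_eq_zero _
  -- Both graded pieces are quotients of `𝒯 n`, so only the kernels need comparing. If `x` drops in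
  -- filtration, its representative by the `w i` of degree `n` lies in the span of those of smaller
  -- degree; independence then forces all its coefficients to vanish.
  have hker : LinearMap.ker q = LinearMap.ker h := by
    ext ⟨x, hx⟩
    rw [LinearMap.mem_ker, LinearMap.mem_ker, hqk, hhk]
    refine ⟨hkey n x hx, fun hxP => ?_⟩
    obtain ⟨y, hy, hxy⟩ := exists_mem_span_of_mem hspan hx
    have hy' : y ∈ 𝒯 n := Submodule.span_le.2 (by rintro _ ⟨i, rfl, rfl⟩; exact hw i) hy
    have h1 := sub_mem hxP
      (hkey n (x - y) (sub_mem hx hy') (by rw [map_sub, hxy, sub_self]))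
    rw [← map_sub, sub_sub_cancel] at h1
    have h2 := filtLT_le_span hw hkey hspan n h1
    have hdisj : Disjoint {i | deg i = n} {i | deg i < n} :=
      Set.disjoint_left.2 fun i (h : deg i = n) h' => absurd h' (not_lt.2 h.ge)
    have h3 := Submodule.disjoint_def.1 (hli.disjoint_span_image hdisj) _
      (relProj_mem_span_image hy) h2
    obtain ⟨c, -, rfl⟩ := (Finsupp.mem_span_image_iff_linearCombination ℂ).1 hy
    have hc : c = 0 := by
      apply linearIndependent_iff.1 hli
      rw [← h3]
      exact (Finsupp.apply_linearCombination ℂ (relProj P).toLinearMap w c).symm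
    rw [hxy, hc, map_zero, map_zero]
  refine ⟨(q.quotKerEquivOfSurjective hq).symm ≪≫ₗ Submodule.quotEquivOfEq _ _ hker ≪≫ₗ
    h.quotKerEquivOfSurjective hh, fun x hx => ?_⟩
  have e : (⟨relProj (quadraticPart 𝒯 P) x, relProj_mem_quadraticPiece 𝒯 P hx⟩ :
      quadraticPiece 𝒯 P n) = q.quotKerEquivOfSurjective hq (Submodule.Quotient.mk ⟨x, hx⟩) := rfl
  rw [e, LinearEquiv.trans_apply, LinearEquiv.trans_apply, LinearEquiv.symm_apply_apply]
  rfl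

end PBWCriterion

/-! ### Ordered sequences and sorted words -/

section Words

variable {N : ℕ}

/-- The list of pairs in which `(i_s, j_s)` is repeated `n_s` times. -/
def expandSeq (L : List (Fin N × Fin N × ℕ)) : List (Fin N × Fin N) :=
  L.flatMap fun s => List.replicate s.2.2 (s.1, s.2.1)

theorem prod_map_expandSeq {M : Type*} [Monoid M] (f : Fin N × Fin N → M)
    (L : List (Fin N × Fin N × ℕ)) :
    ((expandSeq L).map f).prod = (L.map fun s => f (s.1, s.2.1) ^ s.2.2).prod := by
  induction L with
  | nil => rfl
  | cons a L ih =>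
    rw [expandSeq, List.flatMap_cons, List.map_append, List.prod_append, List.map_replicate,
      List.prod_replicate, List.map_cons, List.prod_cons, ← ih, expandSeq]

/-- The condition that defines `OrderedSeq`. -/
def IsOrderedSeq (L : List (Fin N × Fin N × ℕ)) : Prop :=
  (∀ s ∈ L, 0 < s.2.2) ∧
    L.Pairwise (fun s t => s.1 ≤ t.1 ∧ s.2.1 ≤ t.2.1 ∧ ¬ (s.1 = t.1 ∧ s.2.1 = t.2.1))

/-- The componentwise order on pairs of indices. -/
def PairLE (p q : Fin N × Fin N) : Prop := p.1 ≤ q.1 ∧ p.2 ≤ q.2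

theorem IsOrderedSeq.tail {a : Fin N × Fin N × ℕ} {L : List (Fin N × Fin N × ℕ)}
    (h : IsOrderedSeq (a :: L)) : IsOrderedSeq L :=
  ⟨fun s hs => h.1 s (List.mem_cons_of_mem _ hs), (List.pairwise_cons.1 h.2).2⟩

theorem mem_expandSeq {L : List (Fin N × Fin N × ℕ)} {p : Fin N × Fin N} (h : p ∈ expandSeq L) :
    ∃ s ∈ L, p = (s.1, s.2.1) := by
  obtain ⟨s, hs, hp⟩ := List.mem_flatMap.1 h
  exact ⟨s, hs, List.eq_of_mem_replicate hp⟩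

theorem pairwise_expandSeq {L : List (Fin N × Fin N × ℕ)} (h : IsOrderedSeq L) :
    (expandSeq L).Pairwise PairLE := by
  induction L with
  | nil => exact List.Pairwise.nil
  | cons a L ih =>
    rw [expandSeq, List.flatMap_cons, List.pairwise_append]
    refine ⟨List.pairwise_replicate.2 (Or.inr ⟨le_rfl, le_rfl⟩), ih h.tail, ?_⟩
    intro p hp q hq
    obtain ⟨s, hs, rfl⟩ := mem_expandSeq hq
    rw [List.eq_of_mem_replicate hp]
    have := (List.pairwise_cons.1 h.2).1 s hs
    exact ⟨this.1, this.2.1⟩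

theorem notMem_expandSeq_tail {i j : Fin N} {n : ℕ} {L : List (Fin N × Fin N × ℕ)}
    (h : IsOrderedSeq ((i, j, n) :: L)) : (i, j) ∉ expandSeq L := by
  intro hm
  obtain ⟨s, hs, e⟩ := mem_expandSeq hm
  have := (List.pairwise_cons.1 h.2).1 s hs
  exact this.2.2 ⟨(Prod.mk.inj e).1, (Prod.mk.inj e).2⟩

theorem expandSeq_cons (i j : Fin N) (n : ℕ) (L : List (Fin N × Fin N × ℕ)) :
    expandSeq ((i, j, n) :: L) = List.replicate n (i, j) ++ expandSeq L := rfl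

theorem expandSeq_injective {L L' : List (Fin N × Fin N × ℕ)} (h : IsOrderedSeq L)
    (h' : IsOrderedSeq L') (e : expandSeq L = expandSeq L') : L = L' := by
  induction L generalizing L' with
  | nil =>
    cases L' with
    | nil => rfl
    | cons a L' =>
      obtain ⟨i, j, n⟩ := a
      obtain ⟨n, rfl⟩ := Nat.exists_eq_succ_of_ne_zero (h'.1 _ List.mem_cons_self).ne'
      exact absurd e (List.cons_ne_nil _ _).symm
  | cons a L ih =>
    obtain ⟨i, j, n⟩ := a
    have hn : 0 < n := h.1 _ List.mem_cons_self
    cases L' with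
    | nil =>
      obtain ⟨n, rfl⟩ := Nat.exists_eq_succ_of_ne_zero hn.ne'
      exact absurd e (List.cons_ne_nil _ _)
    | cons a' L' =>
      obtain ⟨i', j', n'⟩ := a'
      have hn' : 0 < n' := h'.1 _ List.mem_cons_self
      rw [expandSeq_cons, expandSeq_cons] at e
      have hp : (i, j) = (i', j') := by
        obtain ⟨n, rfl⟩ := Nat.exists_eq_succ_of_ne_zero hn.ne'
        obtain ⟨n', rfl⟩ := Nat.exists_eq_succ_of_ne_zero hn'.ne'
        exact (List.cons.inj e).1
      obtain ⟨rfl, rfl⟩ := Prod.mk.inj hp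
      -- The pair `(i, j)` does not recur in either tail, so counting it recovers the first
      -- exponent.
      have hc := congrArg (List.count (i, j)) e
      rw [List.count_append, List.count_append, List.count_replicate_self,
        List.count_replicate_self, List.count_eq_zero_of_not_mem (notMem_expandSeq_tail h),
        List.count_eq_zero_of_not_mem (notMem_expandSeq_tail h')] at hc
      obtain rfl : n = n' := hc
      rw [ih h.tail h'.tail (List.append_cancel_left e)]

/-- This is run-length encoding: a new first pair either increases the leading exponent or opens a
new block. -/
theorem exists_expandSeq_eq {l : List (Fin N × Fin N)} (hl : l.Pairwise PairLE) :
    ∃ L, IsOrderedSeq L ∧ expandSeq L = l := by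
  induction l with
  | nil => exact ⟨[], ⟨by simp, List.Pairwise.nil⟩, rfl⟩
  | cons p l ih =>
    obtain ⟨i, j⟩ := p
    obtain ⟨hp, hl⟩ := List.pairwise_cons.1 hl
    obtain ⟨L, hL, rfl⟩ := ih hl
    have hpL : ∀ s ∈ L, i ≤ s.1 ∧ j ≤ s.2.1 := by
      intro s hs
      refine hp (s.1, s.2.1) (List.mem_flatMap.2 ⟨s, hs, ?_⟩)
      exact List.mem_replicate.2 ⟨(hL.1 s hs).ne', rfl⟩
    have hcons : (∀ s ∈ L, ¬ (i = s.1 ∧ j = s.2.1)) → IsOrderedSeq ((i, j, 1) :: L) := by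
      intro hne
      refine ⟨fun s hs => ?_, List.pairwise_cons.2
        ⟨fun s hs => ⟨(hpL s hs).1, (hpL s hs).2, hne s hs⟩, hL.2⟩⟩
      rcases List.mem_cons.1 hs with rfl | hs
      · exact Nat.one_pos
      · exact hL.1 s hs
    cases L with
    | nil => exact ⟨[(i, j, 1)], hcons (by simp), rfl⟩
    | cons a L =>
      obtain ⟨i', j', n⟩ := a
      have hL' := List.pairwise_cons.1 hL.2
      by_cases h : i = i' ∧ j = j'
      · obtain ⟨rfl, rfl⟩ := h
        refine ⟨(i, j, n + 1) :: L, ⟨fun s hs => ?_, List.pairwise_cons.2 ⟨hL'.1, hL'.2⟩⟩, rfl⟩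
        rcases List.mem_cons.1 hs with rfl | hs
        · exact Nat.succ_pos n
        · exact hL.1 s (List.mem_cons_of_mem _ hs)
      · refine ⟨(i, j, 1) :: (i', j', n) :: L, hcons fun s hs hs' => ?_, rfl⟩
        rcases List.mem_cons.1 hs with rfl | hs
        · exact h hs'
        -- The leading pair `(i', j')` lies between `(i, j)` and any later pair, so a later
        -- recurrence of `(i, j)` would force `(i', j') = (i, j)`.
        · have h1 := hL'.1 s hs
          have h2 := hpL _ List.mem_cons_self
          exact h ⟨le_antisymm h2.1 (hs'.1 ▸ h1.1), le_antisymm h2.2 (hs'.2 ▸ h1.2.1)⟩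

/-- A sequence is determined by the multisets of its first and of its second indices. -/
theorem orderedSeq_ext {L L' : List (Fin N × Fin N × ℕ)} (h : IsOrderedSeq L)
    (h' : IsOrderedSeq L')
    (e₁ : ((expandSeq L).map Prod.fst : Multiset (Fin N)) = (expandSeq L').map Prod.fst)
    (e₂ : ((expandSeq L).map Prod.snd : Multiset (Fin N)) = (expandSeq L').map Prod.snd) :
    L = L' := by
  apply expandSeq_injective h h'
  -- Both coordinate lists are sorted, hence determined by their multisets; zipping them recovers
  -- the list of pairs.
  have hs : ∀ {l l' : List (Fin N × Fin N)} (f : Fin N × Fin N → Fin N),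
      (∀ p q, PairLE p q → f p ≤ f q) → l.Pairwise PairLE → l'.Pairwise PairLE →
      ((l.map f : List (Fin N)) : Multiset (Fin N)) = (l'.map f : List (Fin N)) →
      l.map f = l'.map f := by
    intro l l' f hf hl hl' e
    have aux : ∀ {l : List (Fin N × Fin N)}, l.Pairwise PairLE → (l.map f).Pairwise (· ≤ ·) :=
      fun hl => List.pairwise_map.2 (hl.imp (hf _ _))
    exact (Multiset.coe_eq_coe.1 e).eq_of_pairwise' (aux hl) (aux hl')
  have h1 := hs Prod.fst (fun p q h => h.1) (pairwise_expandSeq h) (pairwise_expandSeq h') e₁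
  have h2 := hs Prod.snd (fun p q h => h.2) (pairwise_expandSeq h) (pairwise_expandSeq h') e₂
  have hz : ∀ l : List (Fin N × Fin N), (l.map Prod.fst).zip (l.map Prod.snd) = l := by
    intro l
    induction l with
    | nil => rfl
    | cons p l ih => rw [List.map_cons, List.map_cons, List.zip_cons_cons, ih]
  rw [← hz (expandSeq L), ← hz (expandSeq L'), h1, h2]

/-- Distinct ordered monomials have distinct leading terms, since the two index multisets and `σ`
determine the monomial. -/
theorem linearIndependent_monomialOp (g : ℂ) :
    LinearIndependent ℂ
      (monomialOp g : OrderedSeq N × Equiv.Perm (Fin N) → Module.End ℂ (RatFun N)) := by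
  refine linearIndependent_of_triangular (linearIndependent_normalOp (N := N) g)
    (fun p => Multiset.card p.1)
    (e := fun m => (↑((expandSeq m.1.1).map Prod.fst), ↑((expandSeq m.1.1).map Prod.snd), m.2))
    ?_ fun m => ?_
  · rintro ⟨⟨L, h⟩, σ⟩ ⟨⟨L', h'⟩, σ'⟩ e
    obtain ⟨e₁, e₂, rfl⟩ : _ ∧ _ ∧ σ = σ' := by simpa only [Prod.mk.injEq] using e
    exact Prod.ext (Subtype.ext (orderedSeq_ext h h' e₁ e₂)) rfl
  · have h := prod_EOp_sub_mem_normalLT (g := g) (expandSeq m.1.1) m.2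
    rw [prod_map_expandSeq] at h
    simp only [Multiset.coe_card, List.length_map]
    exact h

/-! ### Sorting words -/

/-- If the factors `E i j` satisfy the homogeneous relations, then a product of them depends only
on the multisets of the first and of the second indices. -/
theorem prod_zipWith_eq_of_perm {M : Type*} [Monoid M] {E : Fin N → Fin N → M}
    (h : ∀ i j k l, E i j * E k l = E k j * E i l) {I I' : List (Fin N)} (hI : I.Perm I')
    (J : List (Fin N)) (hJ : J.length = I.length) :
    (List.zipWith E I J).prod = (List.zipWith E I' J).prod := by
  induction hI generalizing J with
  | nil => rfl
  | cons i _ ih =>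
    cases J with
    | nil => rfl
    | cons j J =>
      rw [List.zipWith_cons_cons, List.zipWith_cons_cons, List.prod_cons, List.prod_cons,
        ih J (Nat.succ.inj hJ)]
  | swap i k I =>
    match J with
    | [] => rfl
    | [_] => simp at hJ
    | j :: l :: J =>
      simp only [List.zipWith_cons_cons, List.prod_cons]
      rw [← mul_assoc, h, mul_assoc]
  | trans h₁ _ ih₁ ih₂ => rw [ih₁ J hJ, ih₂ J (hJ.trans h₁.length_eq)]

theorem exists_orderedSeq_prod_eq {M : Type*} [Monoid M] {E : Fin N → Fin N → M}
    (h₁ : ∀ i j k l, E i j * E k l = E k j * E i l)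
    (h₂ : ∀ i j k l, E i j * E k l = E i l * E k j) (l : List (Fin N × Fin N)) :
    ∃ L : OrderedSeq N, (expandSeq L.1).length = l.length ∧
      (l.map fun p => E p.1 p.2).prod = ((expandSeq L.1).map fun p => E p.1 p.2).prod := by
  set I := l.map Prod.fst with hI
  set J := l.map Prod.snd with hJ
  have hIl : I.length = l.length := by rw [hI, List.length_map]
  have hJl : J.length = l.length := by rw [hJ, List.length_map]
  set I' := I.mergeSort (· ≤ ·) with hI'
  set J' := J.mergeSort (· ≤ ·) with hJ'
  have hIp : I'.Perm I := List.mergeSort_perm _ _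
  have hJp : J'.Perm J := List.mergeSort_perm _ _
  have hIs : I'.Pairwise (· ≤ ·) := by
    simpa using List.pairwise_mergeSort' (· ≤ ·) I
  have hJs : J'.Pairwise (· ≤ ·) := by
    simpa using List.pairwise_mergeSort' (· ≤ ·) J
  have hlen : I'.length = J'.length := by
    rw [hIp.length_eq, hJp.length_eq, hIl, hJl]
  have e0 : (l.map fun p => E p.1 p.2) = List.zipWith E I J := by
    rw [hI, hJ, List.zipWith_map, List.zipWith_self]
  -- The second indices are sorted by the argument for the first ones, applied to the transposed
  -- family.
  have e1 : (List.zipWith E I J).prod = (List.zipWith E I' J').prod := by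
    rw [prod_zipWith_eq_of_perm h₁ hIp.symm J (by rw [hIl, hJl]), List.zipWith_comm,
      prod_zipWith_eq_of_perm (E := fun b a => E a b) (fun i j k l => h₂ j i l k) hJp.symm I'
        (by rw [hIp.length_eq, hIl, hJl]), List.zipWith_comm]
  have e2 : List.zipWith E I' J' = (I'.zip J').map fun p => E p.1 p.2 := by
    rw [List.zip, List.map_zipWith]
  have hs : (I'.zip J').Pairwise PairLE := by
    generalize I' = a at hIs hlen
    generalize J' = b at hJs hlen
    clear * - hIs hJs
    induction a generalizing b with
    | nil => exact List.Pairwise.nil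
    | cons i a ih =>
      cases b with
      | nil => exact List.Pairwise.nil
      | cons j b =>
        rw [List.zip_cons_cons, List.pairwise_cons]
        obtain ⟨h1, h2⟩ := List.pairwise_cons.1 hIs
        obtain ⟨h3, h4⟩ := List.pairwise_cons.1 hJs
        exact ⟨fun p hp => ⟨h1 _ (List.of_mem_zip hp).1, h3 _ (List.of_mem_zip hp).2⟩,
          ih h2 _ h4⟩
  obtain ⟨L, hL, hLe⟩ := exists_expandSeq_eq hs
  refine ⟨⟨L, hL⟩, ?_, ?_⟩
  · rw [hLe, List.length_zip, ← hlen, min_self, hIp.length_eq, hIl]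
  · rw [hLe, e0, e1, e2]

end Words

/-! ### The grading of the smash product -/

section Smash

variable {N : ℕ}

/-- The component of degree `n` of the tensor algebra. -/
abbrev tensorGrading (N n : ℕ) : Submodule ℂ (TensorGl N) :=
  LinearMap.range (TensorAlgebra.ι ℂ : V N ⊗[ℂ] V N →ₗ[ℂ] TensorGl N) ^ n

theorem sum_single_coeff (x : Smash N) : ∑ σ, SkewMonoidAlgebra.single σ (x.coeff σ) = x := by
  conv_rhs => rw [← SkewMonoidAlgebra.sum_single x, SkewMonoidAlgebra.sum_def]
  exact (Finsupp.sum_fintype _ _ fun σ => SkewMonoidAlgebra.single_zero σ).symm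

theorem single_mem_smashGrading {n : ℕ} (σ : Equiv.Perm (Fin N)) {t : TensorGl N}
    (ht : t ∈ tensorGrading N n) : SkewMonoidAlgebra.single σ t ∈ smashGrading N n := by
  classical
  intro τ
  rw [SkewMonoidAlgebra.coeff_single_apply]
  split_ifs
  · exact ht
  · exact zero_mem _

theorem smul_mem_tensorGrading {n : ℕ} (σ : Equiv.Perm (Fin N)) {t : TensorGl N}
    (ht : t ∈ tensorGrading N n) : σ • t ∈ tensorGrading N n := by
  have h : (tensorGrading N n).map (permT σ).toLinearMap ≤ tensorGrading N n := by
    rw [Submodule.map_pow]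
    refine pow_le_pow_left' ?_ n
    rintro _ ⟨_, ⟨m, rfl⟩, rfl⟩
    exact ⟨TensorProduct.map (permV σ) (permV σ) m, by simp [permT]⟩
  exact h (Submodule.mem_map_of_mem (f := (permT σ).toLinearMap) ht)

theorem mul_mem_smashGrading {m n : ℕ} {x y : Smash N} (hx : x ∈ smashGrading N m)
    (hy : y ∈ smashGrading N n) : x * y ∈ smashGrading N (m + n) := by
  rw [← sum_single_coeff x, ← sum_single_coeff y, Finset.sum_mul_sum]
  refine Submodule.sum_mem _ fun σ _ => Submodule.sum_mem _ fun τ _ => ?_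
  rw [SkewMonoidAlgebra.single_mul_single]
  apply single_mem_smashGrading
  rw [tensorGrading, pow_add]
  exact Submodule.mul_mem_mul (hx σ) (smul_mem_tensorGrading σ (hy τ))

theorem iSup_smashGrading : ⨆ n, smashGrading N n = ⊤ := by
  rw [eq_top_iff]
  intro x _
  rw [← sum_single_coeff x]
  refine Submodule.sum_mem _ fun σ _ => ?_
  have h : (⨆ n, tensorGrading N n) ≤
      (⨆ n, smashGrading N n).comap (SkewMonoidAlgebra.lsingle (R := ℂ) σ) :=
    iSup_le fun n t ht => le_iSup (smashGrading N) n (single_mem_smashGrading σ ht)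
  rw [(DirectSum.Decomposition.isInternal (tensorGrading N)).submodule_iSup_eq_top] at h
  exact h (Submodule.mem_top (x := x.coeff σ))

/-- The projection of the smash product to its component of degree `n`. -/
def smashProj (N n : ℕ) : Smash N →ₗ[ℂ] Smash N :=
  ∑ σ, SkewMonoidAlgebra.lsingle (R := ℂ) σ ∘ₗ GradedAlgebra.proj (tensorGrading N) n ∘ₗ
    Finsupp.lapply σ ∘ₗ (SkewMonoidAlgebra.coeffLinearEquiv (S := ℂ)).toLinearMap

theorem smashProj_apply (n : ℕ) (x : Smash N) : smashProj N n x =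
    ∑ σ, SkewMonoidAlgebra.single σ (GradedAlgebra.proj (tensorGrading N) n (x.coeff σ)) := by
  rw [smashProj, LinearMap.sum_apply]
  rfl

theorem smashProj_of_mem {n : ℕ} {x : Smash N} (hx : x ∈ smashGrading N n) :
    smashProj N n x = x := by
  rw [smashProj_apply]
  conv_rhs => rw [← sum_single_coeff x]
  refine Finset.sum_congr rfl fun σ _ => ?_
  rw [GradedAlgebra.proj_apply, DirectSum.decompose_of_mem_same _ (hx σ)]

theorem smashProj_of_mem_ne {m n : ℕ} (h : m ≠ n) {x : Smash N} (hx : x ∈ smashGrading N m) :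
    smashProj N n x = 0 := by
  rw [smashProj_apply]
  refine Finset.sum_eq_zero fun σ _ => ?_
  rw [GradedAlgebra.proj_apply, DirectSum.decompose_of_mem_ne _ (hx σ) h,
    SkewMonoidAlgebra.single_zero]

/-! ### Generators of the smash product -/

theorem genE_mem (i j : Fin N) : genE i j ∈ smashGrading N 1 :=
  single_mem_smashGrading 1 (by rw [tensorGrading, pow_one]; exact LinearMap.mem_range_self _ _)

theorem genPerm_mem (σ : Equiv.Perm (Fin N)) : genPerm σ ∈ smashGrading N 0 :=
  single_mem_smashGrading σ (by rw [tensorGrading, pow_zero]; exact Submodule.one_le.1 le_rfl)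

theorem one_mem_smashGrading : (1 : Smash N) ∈ smashGrading N 0 := genPerm_mem 1

theorem genS_mem (g : ℂ) (i j : Fin N) : genS g i j ∈ smashGrading N 0 := by
  rw [genS]
  split_ifs
  · exact add_mem one_mem_smashGrading
      (Submodule.smul_mem _ _ (Submodule.sum_mem _ fun k _ => genPerm_mem _))
  · exact neg_mem (Submodule.smul_mem _ _ (genPerm_mem _))

/-- The monomial `E_{i_1 j_1}^{n_1} … E_{i_k j_k}^{n_k} σ` in the smash product. -/
def smashMonomial (m : OrderedSeq N × Equiv.Perm (Fin N)) : Smash N :=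
  ((expandSeq m.1.1).map fun p => genE p.1 p.2).prod * genPerm m.2

theorem prod_genE_mem (l : List (Fin N × Fin N)) :
    (l.map fun p => genE p.1 p.2).prod ∈ smashGrading N l.length := by
  induction l with
  | nil => exact one_mem_smashGrading
  | cons p l ih =>
    rw [List.map_cons, List.prod_cons, List.length_cons, add_comm]
    exact mul_mem_smashGrading (genE_mem _ _) ih

theorem smashMonomial_mem (m : OrderedSeq N × Equiv.Perm (Fin N)) :
    smashMonomial m ∈ smashGrading N (expandSeq m.1.1).length :=
  mul_mem_smashGrading (prod_genE_mem _) (genPerm_mem m.2)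

open Pointwise in
theorem tensorGrading_eq_span (n : ℕ) : tensorGrading N n = Submodule.span ℂ
    (Set.range (fun p : Fin N × Fin N => TensorAlgebra.ι ℂ
      ((Pi.single p.1 1 : V N) ⊗ₜ[ℂ] (Pi.single p.2 1 : V N))) ^ n) := by
  have h := ((Pi.basisFun ℂ (Fin N)).tensorProduct (Pi.basisFun ℂ (Fin N))).span_eq
  rw [tensorGrading, ← Submodule.span_pow, LinearMap.range_eq_map, ← h, Submodule.map_span,
    ← Set.range_comp]
  congr 4
  funext p
  obtain ⟨i, j⟩ := p
  rw [Module.Basis.tensorProduct_apply, Pi.basisFun_apply, Pi.basisFun_apply]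

theorem single_mul_genPerm (σ : Equiv.Perm (Fin N)) (t : TensorGl N) :
    SkewMonoidAlgebra.single σ t = SkewMonoidAlgebra.single 1 t * genPerm σ := by
  rw [genPerm, SkewMonoidAlgebra.single_mul_single, one_mul, smul_one, mul_one]

open Pointwise in
/-- The words of length `n` span the component of degree `n`. -/
theorem smashGrading_le {n : ℕ} {S : Submodule ℂ (Smash N)}
    (h : ∀ (l : List (Fin N × Fin N)) (σ : Equiv.Perm (Fin N)), l.length = n →
      (l.map fun p => genE p.1 p.2).prod * genPerm σ ∈ S) : smashGrading N n ≤ S := by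
  intro x hx
  rw [← sum_single_coeff x]
  refine Submodule.sum_mem _ fun σ _ => ?_
  have hle : tensorGrading N n ≤ S.comap (SkewMonoidAlgebra.lsingle (R := ℂ) σ) := by
    rw [tensorGrading_eq_span, Submodule.span_le]
    intro t ht
    obtain ⟨f, rfl⟩ := Set.mem_pow.1 ht
    choose p hp using fun i => (f i).2
    change SkewMonoidAlgebra.single σ _ ∈ S
    have e := h (List.ofFn p) σ (List.length_ofFn)
    rw [single_mul_genPerm]
    convert e using 2
    change SkewMonoidAlgebra.singleOneRingHom (G := Equiv.Perm (Fin N)) _ = _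
    rw [map_list_prod, List.map_ofFn, List.map_ofFn]
    congr 2
    funext i
    change SkewMonoidAlgebra.single 1 (f i : TensorGl N) = _
    rw [← hp i]
    rfl
  exact hle (hx σ)

/-! ### The relations -/

theorem genE_mul_genE_mem (i j k l : Fin N) : genE i j * genE k l ∈ smashGrading N 2 :=
  mul_mem_smashGrading (genE_mem i j) (genE_mem k l)

theorem genE_mul_genS_mem (g : ℂ) (i j k l : Fin N) : genE i j * genS g k l ∈ smashGrading N 1 :=
  mul_mem_smashGrading (genE_mem i j) (genS_mem g k l)

theorem genS_mul_genE_mem (g : ℂ) (i j k l : Fin N) : genS g i j * genE k l ∈ smashGrading N 1 :=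
  mul_mem_smashGrading (genS_mem g i j) (genE_mem k l)

/-- Each `S_{kl}` has degree zero, so dropping it changes the relation only in degree one. -/
theorem right_relation_sub_mem (g : ℂ) (i j k l : Fin N) :
    genE i j * (genE k l + genS g k l) - genE i l * (genE k j + genS g k j) -
      (genE i j * genE k l - genE i l * genE k j) ∈ smashGrading N 0 ⊔ smashGrading N 1 := by
  have e : genE i j * (genE k l + genS g k l) - genE i l * (genE k j + genS g k j) -
      (genE i j * genE k l - genE i l * genE k j) =
      genE i j * genS g k l - genE i l * genS g k j := by noncomm_ring
  rw [e]
  exact Submodule.mem_sup_right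
    (sub_mem (genE_mul_genS_mem g i j k l) (genE_mul_genS_mem g i l k j))

theorem left_relation_sub_mem (g : ℂ) (i j k l : Fin N) :
    (genE i j + genS g i j) * genE k l - (genE k j + genS g k j) * genE i l -
      (genE i j * genE k l - genE k j * genE i l) ∈ smashGrading N 0 ⊔ smashGrading N 1 := by
  have e : (genE i j + genS g i j) * genE k l - (genE k j + genS g k j) * genE i l -
      (genE i j * genE k l - genE k j * genE i l) =
      genS g i j * genE k l - genS g k j * genE i l := by noncomm_ring
  rw [e]
  exact Submodule.mem_sup_right
    (sub_mem (genS_mul_genE_mem g i j k l) (genS_mul_genE_mem g k j i l))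

theorem crossingRelations_mem {g : ℂ} {p : Smash N} (hp : p ∈ crossingRelations N g) :
    p ∈ smashGrading N 0 ⊔ smashGrading N 1 ⊔ smashGrading N 2 := by
  rcases hp with ⟨i, j, k, l, rfl⟩ | ⟨i, j, k, l, rfl⟩
  · rw [← sub_add_cancel (genE i j * (genE k l + genS g k l) - _)
      (genE i j * genE k l - genE i l * genE k j)]
    exact Submodule.add_mem_sup (right_relation_sub_mem g i j k l)
      (sub_mem (genE_mul_genE_mem _ _ _ _) (genE_mul_genE_mem _ _ _ _))
  · rw [← sub_add_cancel ((genE i j + genS g i j) * genE k l - _)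
      (genE i j * genE k l - genE k j * genE i l)]
    exact Submodule.add_mem_sup (left_relation_sub_mem g i j k l)
      (sub_mem (genE_mul_genE_mem _ _ _ _) (genE_mul_genE_mem _ _ _ _))

/-- The homogeneous quadratic algebra is spanned in degree `n` by the ordered monomials. -/
theorem relProj_quadraticPart_mem_span (g : ℂ) (n : ℕ) (x : Smash N) (hx : x ∈ smashGrading N n) :
    relProj (quadraticPart (smashGrading N) (crossingRelations N g)) x ∈
      Submodule.span ℂ ((fun m =>
        relProj (quadraticPart (smashGrading N) (crossingRelations N g)) (smashMonomial m)) ''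
          {m | (expandSeq m.1.1).length = n}) := by
  set R := quadraticPart (smashGrading N) (crossingRelations N g) with hR
  have h₁ : ∀ i j k l : Fin N, relProj R (genE i j) * relProj R (genE k l) =
      relProj R (genE k j) * relProj R (genE i l) := by
    intro i j k l
    rw [← map_mul, ← map_mul, ← sub_eq_zero, ← map_sub]
    exact relProj_eq_zero_of_mem ⟨sub_mem (genE_mul_genE_mem _ _ _ _) (genE_mul_genE_mem _ _ _ _),
      _, Or.inr ⟨i, j, k, l, rfl⟩, left_relation_sub_mem g i j k l⟩
  have h₂ : ∀ i j k l : Fin N, relProj R (genE i j) * relProj R (genE k l) =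
      relProj R (genE i l) * relProj R (genE k j) := by
    intro i j k l
    rw [← map_mul, ← map_mul, ← sub_eq_zero, ← map_sub]
    exact relProj_eq_zero_of_mem ⟨sub_mem (genE_mul_genE_mem _ _ _ _) (genE_mul_genE_mem _ _ _ _),
      _, Or.inl ⟨i, j, k, l, rfl⟩, right_relation_sub_mem g i j k l⟩
  refine smashGrading_le (S := (Submodule.span ℂ _).comap (relProj R).toLinearMap) ?_ hx
  intro l σ hl
  obtain ⟨L, hL, e⟩ := exists_orderedSeq_prod_eq
    (E := fun i j : Fin N => relProj R (genE i j)) h₁ h₂ l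
  refine Submodule.subset_span ⟨(L, σ), hL.trans hl, ?_⟩
  change relProj R (smashMonomial (L, σ)) = relProj R _
  rw [smashMonomial, map_mul, map_mul, map_list_prod, map_list_prod, List.map_map, List.map_map]
  exact congrArg (· * relProj R (genPerm σ)) e.symm

/-! ### The homomorphism to the algebra of operators -/

/-- The linear map `e_i ⊗ e_j ↦ E_{ij}`. -/
def tensorToEnd (N : ℕ) (g : ℂ) : V N ⊗[ℂ] V N →ₗ[ℂ] Module.End ℂ (RatFun N) :=
  ((Pi.basisFun ℂ (Fin N)).tensorProduct (Pi.basisFun ℂ (Fin N))).constr ℂ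
    fun p => EOp g p.1 p.2

theorem tensorToEnd_single (g : ℂ) (i j : Fin N) :
    tensorToEnd N g (Pi.single i 1 ⊗ₜ[ℂ] Pi.single j 1) = EOp g i j := by
  have h := ((Pi.basisFun ℂ (Fin N)).tensorProduct (Pi.basisFun ℂ (Fin N))).constr_basis ℂ
    (fun p => EOp g p.1 p.2) (i, j)
  rwa [Module.Basis.tensorProduct_apply, Pi.basisFun_apply, Pi.basisFun_apply] at h

theorem tensorToEnd_permV (g : ℂ) (σ : Equiv.Perm (Fin N)) (m : V N ⊗[ℂ] V N) :
    tensorToEnd N g (TensorProduct.map (permV σ) (permV σ) m) * permOp σ =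
      permOp σ * tensorToEnd N g m := by
  have h : LinearMap.mulRight ℂ (permOp σ) ∘ₗ tensorToEnd N g ∘ₗ
      TensorProduct.map (permV σ) (permV σ) =
      LinearMap.mulLeft ℂ (permOp σ) ∘ₗ tensorToEnd N g := by
    refine ((Pi.basisFun ℂ (Fin N)).tensorProduct (Pi.basisFun ℂ (Fin N))).ext fun ⟨i, j⟩ => ?_
    rw [Module.Basis.tensorProduct_apply, Pi.basisFun_apply, Pi.basisFun_apply]
    change tensorToEnd N g (permV σ _ ⊗ₜ permV σ _) * permOp σ = permOp σ * tensorToEnd N g _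
    rw [permV_single, permV_single, tensorToEnd_single, tensorToEnd_single, permOp_mul_EOp]
  exact LinearMap.congr_fun h m

/-- The homomorphism of monoids `σ ↦ σ`. -/
def permOpHom (N : ℕ) : Equiv.Perm (Fin N) →* Module.End ℂ (RatFun N) where
  toFun := permOp
  map_one' := permOp_one
  map_mul' := permOp_mul

/-- This covariance is the compatibility needed to extend the map from the tensor algebra to the
smash product. -/
theorem lift_tensorToEnd_smul (g : ℂ) (t : TensorGl N) (σ : Equiv.Perm (Fin N)) :
    TensorAlgebra.lift ℂ (tensorToEnd N g) (σ • t) * permOp σ =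
      permOp σ * TensorAlgebra.lift ℂ (tensorToEnd N g) t := by
  change TensorAlgebra.lift ℂ (tensorToEnd N g) (permT σ t) * permOp σ = _
  induction t using TensorAlgebra.induction with
  | algebraMap r => rw [AlgHom.commutes, AlgHom.commutes, Algebra.commutes]
  | ι m =>
    rw [permT, TensorAlgebra.lift_ι_apply, LinearMap.comp_apply, TensorAlgebra.lift_ι_apply,
      TensorAlgebra.lift_ι_apply, tensorToEnd_permV]
  | mul a b ha hb => rw [map_mul, map_mul, map_mul, mul_assoc, hb, ← mul_assoc, ha, mul_assoc]
  | add a b ha hb => rw [map_add, map_add, map_add, add_mul, ha, hb, mul_add]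

/-- The homomorphism of algebras from the smash product to the algebra of operators. -/
def smashHom (N : ℕ) (g : ℂ) : Smash N →ₐ[ℂ] Module.End ℂ (RatFun N) :=
  SkewMonoidAlgebra.liftNCAlgHom (TensorAlgebra.lift ℂ (tensorToEnd N g)) (permOpHom N)
    fun {t σ} => lift_tensorToEnd_smul g t σ

theorem smashHom_single (g : ℂ) (σ : Equiv.Perm (Fin N)) (t : TensorGl N) :
    smashHom N g (SkewMonoidAlgebra.single σ t) =
      TensorAlgebra.lift ℂ (tensorToEnd N g) t * permOp σ :=
  SkewMonoidAlgebra.liftNC_single _ _ _ _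

theorem smashHom_genE (g : ℂ) (i j : Fin N) : smashHom N g (genE i j) = EOp g i j := by
  rw [genE, smashHom_single, permOp_one, mul_one, TensorAlgebra.lift_ι_apply, tensorToEnd_single]

theorem smashHom_genPerm (g : ℂ) (σ : Equiv.Perm (Fin N)) :
    smashHom N g (genPerm σ) = permOp σ := by
  rw [genPerm, smashHom_single, map_one, one_mul]

theorem smashHom_genS (g : ℂ) (i j : Fin N) : smashHom N g (genS g i j) = SOp g i j := by
  rw [genS, SOp]
  split_ifs
  · simp only [map_add, map_one, map_smul, map_sum, smashHom_genPerm]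
  · rw [← neg_smul, map_smul, smashHom_genPerm]

theorem smashHom_relation {g : ℂ} {p : Smash N} (hp : p ∈ crossingRelations N g) :
    smashHom N g p = 0 := by
  rcases hp with ⟨i, j, k, l, rfl⟩ | ⟨i, j, k, l, rfl⟩ <;>
    simp only [map_sub, map_mul, map_add, smashHom_genE, smashHom_genS]
  · rw [EOp_mul_crossing, sub_self]
  · rw [crossing_mul_EOp, sub_self]

theorem smashHom_smashMonomial (g : ℂ) (m : OrderedSeq N × Equiv.Perm (Fin N)) :
    smashHom N g (smashMonomial m) = monomialOp g m := by
  rw [smashMonomial, map_mul, smashHom_genPerm, map_list_prod, List.map_map, monomialOp]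
  congr 1
  rw [← prod_map_expandSeq fun p => EOp g p.1 p.2]
  congr 2
  funext p
  exact smashHom_genE g p.1 p.2

/-! ### Basis of the quotient and its identification with the algebra of operators. -/

/-- The homomorphism from the quotient of the smash product to the algebra of operators. -/
def quotHom (N : ℕ) (g : ℂ) : RelQuot (crossingRelations N g) →ₐ[ℂ] Module.End ℂ (RatFun N) :=
  RingQuot.liftAlgHom ℂ ⟨smashHom N g, by
    rintro x y ⟨hx, rfl⟩
    rw [smashHom_relation hx, map_zero]⟩

theorem quotHom_relProj (g : ℂ) (x : Smash N) :
    quotHom N g (relProj (crossingRelations N g) x) = smashHom N g x :=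
  RingQuot.liftAlgHom_mkAlgHom_apply ℂ _ _ _

theorem smashHom_mem (g : ℂ) (x : Smash N) : smashHom N g x ∈ Hgl N g := by
  have h : (⨆ n, smashGrading N n) ≤
      (Subalgebra.toSubmodule (Hgl N g)).comap (smashHom N g).toLinearMap := by
    refine iSup_le fun n => smashGrading_le fun l σ _ => ?_
    change smashHom N g _ ∈ Hgl N g
    rw [map_mul, smashHom_genPerm, map_list_prod]
    refine mul_mem (list_prod_mem ?_) (permOp_mem g σ)
    intro T hT
    obtain ⟨_, hy, rfl⟩ := List.mem_map.1 hT
    obtain ⟨p, -, rfl⟩ := List.mem_map.1 hy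
    rw [smashHom_genE]
    exact EOp_mem g _ _
  rw [iSup_smashGrading] at h
  exact h (Submodule.mem_top (x := x))

theorem quotHom_mem (g : ℂ) (z : RelQuot (crossingRelations N g)) : quotHom N g z ∈ Hgl N g := by
  obtain ⟨x, rfl⟩ := RingQuot.mkAlgHom_surjective ℂ _ z
  rw [quotHom_relProj]
  exact smashHom_mem g x

theorem exists_quotHom_eq (g : ℂ) {T : Module.End ℂ (RatFun N)} (hT : T ∈ Hgl N g) :
    ∃ z, quotHom N g z = T := by
  have h : Hgl N g ≤ (quotHom N g).range := by
    refine Algebra.adjoin_le ?_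
    rintro _ (⟨k, l, rfl⟩ | ⟨σ, rfl⟩)
    · exact ⟨relProj _ (genE k l), (quotHom_relProj g _).trans (smashHom_genE g k l)⟩
    · exact ⟨relProj _ (genPerm σ), (quotHom_relProj g _).trans (smashHom_genPerm g σ)⟩
  exact h hT

/-- Independence is tested after mapping to operators, where the leading terms are visible. -/
theorem linearIndependent_relProj_smashMonomial (g : ℂ) : LinearIndependent ℂ
    fun m : OrderedSeq N × Equiv.Perm (Fin N) =>
      relProj (crossingRelations N g) (smashMonomial m) := by
  refine LinearIndependent.of_comp (quotHom N g).toLinearMap ?_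
  suffices e : ((quotHom N g).toLinearMap ∘ fun m => relProj (crossingRelations N g)
      (smashMonomial m)) = monomialOp g by
    rw [e]
    exact linearIndependent_monomialOp g
  funext m
  exact (quotHom_relProj g _).trans (smashHom_smashMonomial g m)

theorem relProj_crossingRelations_mem_filtLT (g : ℂ) (n : ℕ) (x : Smash N)
    (hx : x ∈ smashGrading N n)
    (h : relProj (quadraticPart (smashGrading N) (crossingRelations N g)) x = 0) :
    relProj (crossingRelations N g) x ∈ filtLT (smashGrading N) (crossingRelations N g) n :=
  relProj_mem_filtLT_of_relProj_quadraticPart_eq_zero (𝒯 := smashGrading N)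
    (fun {_ _ _ _} hx hy => mul_mem_smashGrading hx hy) iSup_smashGrading (smashProj N)
    (fun _ _ hx => smashProj_of_mem hx) (fun _ _ h _ hx => smashProj_of_mem_ne h hx) hx h

theorem span_relProj_smashMonomial (g : ℂ) : Submodule.span ℂ
    (Set.range fun m : OrderedSeq N × Equiv.Perm (Fin N) =>
      relProj (crossingRelations N g) (smashMonomial m)) = ⊤ :=
  span_relProj_eq_top iSup_smashGrading smashMonomial_mem (relProj_crossingRelations_mem_filtLT g)
    (relProj_quadraticPart_mem_span g)

/-- The ordered monomials form a basis of the quotient of the smash product. -/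
def quotBasis (N : ℕ) (g : ℂ) : Module.Basis (OrderedSeq N × Equiv.Perm (Fin N)) ℂ
    (RelQuot (crossingRelations N g)) :=
  Module.Basis.mk (linearIndependent_relProj_smashMonomial g) (span_relProj_smashMonomial g).ge

theorem quotHom_quotBasis (g : ℂ) (m : OrderedSeq N × Equiv.Perm (Fin N)) :
    quotHom N g (quotBasis N g m) = monomialOp g m := by
  rw [quotBasis, Module.Basis.mk_apply, quotHom_relProj, smashHom_smashMonomial]

/-- A basis of the quotient is sent to a linearly independent family of operators. -/
theorem quotHom_injective (g : ℂ) : Function.Injective (quotHom N g) := by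
  rw [injective_iff_map_eq_zero]
  intro z hz
  rw [← (quotBasis N g).linearCombination_repr z] at hz
  have e := Finsupp.apply_linearCombination ℂ (quotHom N g).toLinearMap (quotBasis N g)
    ((quotBasis N g).repr z)
  have e' : ((quotHom N g).toLinearMap ∘ quotBasis N g) = monomialOp g :=
    funext fun m => quotHom_quotBasis g m
  rw [e'] at e
  exact (quotBasis N g).repr.map_eq_zero_iff.1
    (linearIndependent_iff.1 (linearIndependent_monomialOp g) _ (e.symm.trans hz))

/-- The isomorphism from the quotient of the smash product to `H_g gl(N)`. -/
def quotEquiv (N : ℕ) (g : ℂ) : RelQuot (crossingRelations N g) ≃ₐ[ℂ] Hgl N g :=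
  AlgEquiv.ofBijective ((quotHom N g).codRestrict (Hgl N g) (quotHom_mem g))
    ⟨fun _ _ h => quotHom_injective g (Subtype.ext_iff.1 h), fun ⟨_, hT⟩ =>
      (exists_quotHom_eq g hT).imp fun _ h => Subtype.ext h⟩

theorem coe_quotEquiv (g : ℂ) (z : RelQuot (crossingRelations N g)) :
    (quotEquiv N g z : Module.End ℂ (RatFun N)) = quotHom N g z := rfl

theorem isPBWQuadratic_crossingRelations (N : ℕ) (g : ℂ) :
    IsPBWQuadratic (smashGrading N) (crossingRelations N g) where
  nonhomogeneous_quadratic _ hp := crossingRelations_mem hp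
  graded_iso := gradedIso_of_linearIndependent smashMonomial_mem
    (relProj_crossingRelations_mem_filtLT g) (relProj_quadraticPart_mem_span g)
    (linearIndependent_relProj_smashMonomial g)

end Smash
end DunklGl

end

theorem mainTheorem3 (N : ℕ) (g : ℂ) :
    (∃ Φ : RelQuot (crossingRelations N g) ≃ₐ[ℂ] Hgl N g,
      (∀ i j : Fin N,
        Φ (relProj (crossingRelations N g) (genE i j)) = ⟨EOp g i j, EOp_mem g i j⟩) ∧
      (∀ σ : Equiv.Perm (Fin N),
        Φ (relProj (crossingRelations N g) (genPerm σ)) = ⟨permOp σ, permOp_mem g σ⟩)) ∧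
    (∃ b : Module.Basis (OrderedSeq N × Equiv.Perm (Fin N)) ℂ (Hgl N g),
      ∀ m, (b m : Module.End ℂ (RatFun N)) = monomialOp g m) ∧
    IsPBWQuadratic (smashGrading N) (crossingRelations N g) := by
  refine ⟨⟨quotEquiv N g, fun i j => Subtype.ext ?_, fun σ => Subtype.ext ?_⟩,
    ⟨(quotBasis N g).map (quotEquiv N g).toLinearEquiv, fun m => ?_⟩,
    isPBWQuadratic_crossingRelations N g⟩
  · rw [coe_quotEquiv, quotHom_relProj, smashHom_genE]
  · rw [coe_quotEquiv, quotHom_relProj, smashHom_genPerm]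
  · rw [Module.Basis.map_apply]
    exact quotHom_quotBasis g m
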